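/- Let $p$ be a prime and let $G$ be a group that can be generated by five elements, is nilpotent of class at most $2$, and has exponent $p$ (i.e. $g^p=e$ for all $g\in G$; the trivial group is allowed). Call a group capable if it is isomorphic to $K/Z(K)$ for some group $K$. For groups $G_1,G_2$, a subgroup $H\le Z(G_1)$ and an injective homomorphism $\phi\colon H\to Z(G_2)$, the amalgamated direct product is $$G_1\times_\phi G_2=(G_1\times G_2)/\{(h,\phi(h)^{-1}) : h\in H\}.$$ Then $G$ is one and only one of the following: (i) nontrivial cyclic; (ii) isomorphic to an amalgamated direct product $G_1\times_\phi G_2$ of two nonabelian groups, where $H$ is a nontrivial cyclic subgroup of $[G_1,G_1]$ and $\phi(H)\le [G_2,G_2]$; (iii) capable. -/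

import Mathlib

universe u

/-- A group is capable if it is isomorphic to the central quotient `H ⧸ Z(H)` of some group. -/
def IsCapable (G : Type u) [Group G] : Prop :=
  ∃ (H : Type u) (_ : Group H), Nonempty (G ≃* H ⧸ Subgroup.center H)

/-- The data for an amalgamated direct product of `G` and `K`: a subgroup `H` of the center of `G`
and an embedding `φ` of `H` into the center of `K`. -/
structure CentralAmalgam (G K : Type u) [Group G] [Group K] where
  H : Subgroup G
  H_le_center : H ≤ Subgroup.center G
  φ : H →* K
  φ_injective : Function.Injective φ
  φ_mem_center : ∀ h : H, φ h ∈ Subgroup.center K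

namespace CentralAmalgam

/-- The subgroup `{(h, φ(h)⁻¹) | h ∈ H}` of `G × K`. -/
def kernel {G K : Type u} [Group G] [Group K] (A : CentralAmalgam G K) : Subgroup (G × K) where
  carrier := {x | ∃ h : A.H, x = ((h : G), (A.φ h)⁻¹)}
  one_mem' := ⟨1, Prod.ext (by simp) (by simp)⟩
  mul_mem' := by
    rintro _ _ ⟨a, rfl⟩ ⟨b, rfl⟩
    refine ⟨a * b, Prod.ext rfl ?_⟩
    have h := Subgroup.mem_center_iff.1 (A.φ_mem_center a) (A.φ b)
    simp only [Prod.snd_mul, map_mul]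
    rw [← mul_inv_rev, h]
  inv_mem' := by
    rintro _ ⟨a, rfl⟩
    exact ⟨a⁻¹, by simp⟩

instance kernel_normal {G K : Type u} [Group G] [Group K] (A : CentralAmalgam G K) :
    A.kernel.Normal where
  conj_mem := by
    rintro _ ⟨a, rfl⟩ ⟨g, k⟩
    refine ⟨a, Prod.ext ?_ ?_⟩
    · have h := Subgroup.mem_center_iff.1 (A.H_le_center a.2) g
      simp [h]
    · have h := Subgroup.mem_center_iff.1 (inv_mem (A.φ_mem_center a)) k
      simp [h]

/-- The amalgamated direct product `G ×_φ K`. -/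
abbrev Product {G K : Type u} [Group G] [Group K] (A : CentralAmalgam G K) : Type u :=
  (G × K) ⧸ A.kernel

end CentralAmalgam

/-- `G` is isomorphic to an amalgamated direct product `G₁ ×_φ G₂` of two nonabelian groups,
where `φ` identifies a nontrivial cyclic subgroup of `[G₁, G₁]` with a subgroup of `[G₂, G₂]`. -/
def IsNonabelianCommutatorAmalgam (G : Type u) [Group G] : Prop :=
  ∃ (G₁ G₂ : Type u) (_ : Group G₁) (_ : Group G₂) (A : CentralAmalgam G₁ G₂),
    (¬ ∀ x y : G₁, x * y = y * x) ∧ (¬ ∀ x y : G₂, x * y = y * x) ∧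
    IsCyclic A.H ∧ A.H ≠ ⊥ ∧
    A.H ≤ commutator G₁ ∧ A.φ.range ≤ commutator G₂ ∧
    Nonempty (G ≃* A.Product)

/-!
A group is capable if and only if its epicenter, the intersection of the images of the centers of
all its central extensions, is trivial. In an amalgam over a subgroup of both commutator subgroups
the amalgamated subgroup lies in the epicenter: in a central extension the preimages of the two
factors commute modulo the center, so by the three subgroups lemma each commutes with the derived
subgroup of the other.

Conversely, let `c ≠ 1` lie in the epicenter of a noncyclic `G`. Products of two homomorphisms to
the prime field are cocycles, which forces `c` into the commutator subgroup. Put `V = G/[G, G]` and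
let `b : V × V → Z(G)` be the commutator pairing. For a linear map `T : Z(G) → V*` satisfying the
Jacobi identity relative to `b` there is a central extension of `G` in which the commutator of lifts
of `c` and `x` is `T c x`; so `T c = 0` for every such `T`. As `dim V ≤ 5`, given a form `ω ∘ b` of
rank four with `ω c = 0` and an `ω'` with `ω' c = 1`, one finds `ξ ≠ 0` and `ξ'` with
`(ω' ∘ b) ∧ ξ = (ω ∘ b) ∧ ξ'`, and `T = ω' ⊗ ξ - ω ⊗ ξ'` has `T c = ξ`. Hence the forms `ω ∘ b`
with `ω c = 0` are all decomposable, and such a space of forms again yields a `T` with `T c ≠ 0`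
unless there are `v₁`, `v₂` with `b(v₁, v₂) = c` whose brackets with `V` are all multiples of `c`.
Lifting the `vᵢ` to `xᵢ`, the group is the amalgam of `⟨x₁, x₂⟩` and its centralizer along `⟨c⟩`,
and one last choice of `T` shows that `c` is a product of commutators of the centralizer.
-/

open Function
open scoped commutatorElement IsMulCommutative
open Subgroup (center mem_center_iff closure zpowers)

section FiberProduct

variable {G ι : Type u} [Group G] {E : ι → Type u} [∀ i, Group (E i)]

/-- The fibre product over `G` of the groups `E i`. The component in `G` is recorded separately, so
that the empty fibre product is `G`. -/
def fiberProduct (f : ∀ i, E i →* G) : Subgroup (G × ∀ i, E i) where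
  carrier := {x | ∀ i, f i (x.2 i) = x.1}
  one_mem' i := by simp
  mul_mem' hx hy i := by simp [hx i, hy i]
  inv_mem' hx i := by simp [hx i]

namespace fiberProduct

variable (f : ∀ i, E i →* G)

/-- The projection of a fibre product to its base. -/
def toBase : fiberProduct f →* G := (MonoidHom.fst _ _).comp (fiberProduct f).subtype

variable {f}

theorem toBase_surjective (hf : ∀ i, Surjective (f i)) : Surjective (toBase f) := fun g => by
  choose s hs using fun i => hf i g
  exact ⟨⟨(g, s), hs⟩, rfl⟩

theorem ker_toBase_le_center (hf : ∀ i, (f i).ker ≤ center (E i)) :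
    (toBase f).ker ≤ center (fiberProduct f) := by
  rintro ⟨⟨x, s⟩, hx⟩ (rfl : x = 1)
  refine mem_center_iff.2 fun ⟨⟨y, t⟩, _⟩ => Subtype.ext (Prod.ext (by simp) (funext fun i => ?_))
  exact mem_center_iff.1 (hf i (hx i)) (t i)

theorem snd_mem_center (hf : ∀ i, Surjective (f i)) {z : fiberProduct f}
    (hz : z ∈ center (fiberProduct f)) (i : ι) : z.1.2 i ∈ center (E i) := by
  classical
  refine mem_center_iff.2 fun e => ?_
  choose t ht using fun j => hf j (f i e)
  have ht' : (f i e, update t i e) ∈ fiberProduct f := by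
    intro j
    rcases eq_or_ne j i with rfl | hj
    · simp
    · simp [update_of_ne hj, ht]
  simpa using congrArg (fun w : fiberProduct f => w.1.2 i) (mem_center_iff.1 hz ⟨_, ht'⟩)

end fiberProduct

end FiberProduct

section Epicenter

variable {G : Type u} [Group G]

/-- The epicenter `Z*(G)` of Beyl, Felgner and Schmid: the intersection of the images of the centers
of all central extensions of `G`. -/
def epicenter (G : Type u) [Group G] : Subgroup G :=
  sInf {N | ∃ (E : Type u) (_ : Group E) (f : E →* G),
    Surjective f ∧ f.ker ≤ center E ∧ (center E).map f = N}

theorem epicenter_le_map_center {E : Type u} [Group E] {f : E →* G} (hf : Surjective f)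
    (hker : f.ker ≤ center E) : epicenter G ≤ (center E).map f :=
  sInf_le ⟨E, _, f, hf, hker, rfl⟩

theorem mem_epicenter {g : G} : g ∈ epicenter G ↔ ∀ (E : Type u) [Group E] (f : E →* G),
    Surjective f → f.ker ≤ center E → g ∈ (center E).map f := by
  refine ⟨fun hg E _ f hf hker => epicenter_le_map_center hf hker hg, fun h => ?_⟩
  rw [epicenter, Subgroup.mem_sInf]
  rintro _ ⟨E, _, f, hf, hker, rfl⟩
  exact h E f hf hker

theorem exists_map_center_eq_epicenter (G : Type u) [Group G] :
    ∃ (E : Type u) (_ : Group E) (f : E →* G),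
      Surjective f ∧ f.ker ≤ center E ∧ (center E).map f = epicenter G := by
  choose E instE f hf hker hmap using fun N : {N : Subgroup G | ∃ (E : Type u) (_ : Group E)
    (f : E →* G), Surjective f ∧ f.ker ≤ center E ∧ (center E).map f = N} => N.2
  have hbase := fiberProduct.toBase_surjective hf
  have hcentral := fiberProduct.ker_toBase_le_center hker
  refine ⟨fiberProduct f, inferInstance, fiberProduct.toBase f, hbase, hcentral,
    le_antisymm (le_sInf fun N hN => ?_) (epicenter_le_map_center hbase hcentral)⟩
  rintro _ ⟨z, hz, rfl⟩
  exact (hmap ⟨N, hN⟩).le ⟨_, fiberProduct.snd_mem_center hf hz ⟨N, hN⟩, z.2 ⟨N, hN⟩⟩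

theorem IsCapable.of_mulEquiv {K : Type u} [Group K] (e : G ≃* K) : IsCapable G → IsCapable K :=
  fun ⟨H, _, ⟨e'⟩⟩ => ⟨H, _, ⟨e.symm.trans e'⟩⟩

theorem isCapable_iff_epicenter_eq_bot : IsCapable G ↔ epicenter G = ⊥ := by
  constructor
  · rintro ⟨H, _, ⟨e⟩⟩
    let f : H →* G := e.symm.toMonoidHom.comp (QuotientGroup.mk' (center H))
    have hker : f.ker = center H :=
      (MonoidHom.ker_mulEquiv_comp _ e.symm).trans (QuotientGroup.ker_mk' _)
    have hf : Surjective f := e.symm.surjective.comp (QuotientGroup.mk'_surjective _)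
    rw [eq_bot_iff]
    exact (epicenter_le_map_center hf hker.le).trans ((Subgroup.map_eq_bot_iff _).2 hker.ge).le
  · intro h
    obtain ⟨E, _, f, hf, hker, hmap⟩ := exists_map_center_eq_epicenter G
    have hcenter : center E = f.ker :=
      le_antisymm ((Subgroup.map_eq_bot_iff _).1 (hmap.trans h)) hker
    exact ⟨E, _, ⟨((QuotientGroup.quotientMulEquivOfEq hcenter).trans
      (QuotientGroup.quotientKerEquivOfSurjective f hf)).symm⟩⟩

theorem epicenter_eq_top_of_isCyclic [IsCyclic G] : epicenter G = ⊤ := by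
  refine eq_top_iff.2 fun g _ => mem_epicenter.2 fun E _ f hf hker => ?_
  have := f.isMulCommutative_of_isCyclic_of_ker_le_center hker
  obtain ⟨x, rfl⟩ := hf g
  exact ⟨x, mem_center_iff.2 fun y => mul_comm' y x, rfl⟩

theorem nontrivial_of_not_isCapable (h : ¬ IsCapable G) : Nontrivial G := by
  rw [isCapable_iff_epicenter_eq_bot] at h
  exact Subgroup.nontrivial_iff.1 ⟨_, _, h⟩

theorem not_isCapable_of_isCyclic [IsCyclic G] [Nontrivial G] : ¬ IsCapable G := by
  rw [isCapable_iff_epicenter_eq_bot, epicenter_eq_top_of_isCyclic]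
  exact top_ne_bot

end Epicenter

section Cocycle

/-- The underlying set of the extension of `G` by `A` defined by a cocycle. -/
@[ext] structure TwistedProd (G A : Type*) where
  /-- The component in the quotient. -/
  base : G
  /-- The component in the kernel. -/
  fiber : A

namespace TwistedProd

variable {G A : Type*} [Group G] [AddCommGroup A]

/-- The extension of `G` by `A` defined by a normalized cocycle `f`. -/
@[reducible] def group (f : G → G → A) (h1 : ∀ g, f 1 g = 0)
    (hf : ∀ g h k, f g h + f (g * h) k = f h k + f g (h * k)) : Group (TwistedProd G A) :=
  letI : Mul (TwistedProd G A) := ⟨fun x y => ⟨x.1 * y.1, x.2 + y.2 + f x.1 y.1⟩⟩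
  letI : One (TwistedProd G A) := ⟨⟨1, 0⟩⟩
  letI : Inv (TwistedProd G A) := ⟨fun x => ⟨x.1⁻¹, -x.2 - f x.1⁻¹ x.1⟩⟩
  Group.ofLeftAxioms
    (fun x y z => TwistedProd.ext (mul_assoc _ _ _) (by
      change x.2 + y.2 + f x.1 y.1 + z.2 + f (x.1 * y.1) z.1 =
        x.2 + (y.2 + z.2 + f y.1 z.1) + f x.1 (y.1 * z.1)
      rw [add_assoc (x.2 + y.2), add_comm (f x.1 y.1), ← add_assoc, add_assoc, hf]
      abel))
    (fun x => TwistedProd.ext (one_mul _) (by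
      change 0 + x.2 + f 1 x.1 = x.2
      rw [h1, zero_add, add_zero]))
    (fun x => TwistedProd.ext (inv_mul_cancel _) (by
      change -x.2 - f x.1⁻¹ x.1 + x.2 + f x.1⁻¹ x.1 = 0
      abel))

end TwistedProd

variable {G : Type u} [Group G]

theorem notMem_epicenter_of_cocycle {A : Type} [AddCommGroup A] {f : G → G → A}
    (h1 : ∀ g, f 1 g = 0) (hf : ∀ g h k, f g h + f (g * h) k = f h k + f g (h * k)) {g h : G}
    (hne : f g h ≠ f h g) : g ∉ epicenter G := by
  have h1' (g : G) : f g 1 = 0 := by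
    have h := hf g 1 1
    rwa [mul_one, mul_one, add_left_inj, h1] at h
  let := TwistedProd.group f h1 hf
  have hmul (x y : TwistedProd G A) : x * y = ⟨x.1 * y.1, x.2 + y.2 + f x.1 y.1⟩ := rfl
  let π : TwistedProd G A →* G := MonoidHom.mk' TwistedProd.base (fun _ _ => rfl)
  intro hg
  obtain ⟨⟨_, a⟩, hcenter, rfl⟩ : g ∈ (center (TwistedProd G A)).map π := by
    refine mem_epicenter.1 hg _ π (fun g => ⟨⟨g, 0⟩, rfl⟩) ?_
    rintro ⟨_, a⟩ (rfl : _ = (1 : G))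
    refine mem_center_iff.2 fun ⟨y, b⟩ => ?_
    simp only [hmul, h1, h1', mul_one, one_mul, add_comm]
  have hcomm := congrArg TwistedProd.fiber (mem_center_iff.1 hcenter ⟨h, 0⟩)
  simp only [hmul, zero_add, add_zero] at hcomm
  exact hne (add_left_cancel hcomm).symm

theorem mul_comm_mul_of_mem_epicenter {R : Type} [Ring R] (χ ψ : G →* Multiplicative R) {g : G}
    (hg : g ∈ epicenter G) (h : G) :
    (χ g).toAdd * (ψ h).toAdd = (χ h).toAdd * (ψ g).toAdd := by
  by_contra hne
  refine notMem_epicenter_of_cocycle (f := fun x y => (χ x).toAdd * (ψ y).toAdd) ?_ ?_ hne hg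
  · simp
  · intro x y z
    simp only [map_mul, toAdd_mul, add_mul, mul_add]
    abel

end Cocycle

section CentralProduct

variable {G : Type u} [Group G]

theorem commutator_eq_bot_of_le_center {N : Subgroup G} (hN : N ≤ center G) (M : Subgroup G) :
    ⁅N, M⁆ = ⊥ :=
  Subgroup.commutator_eq_bot_iff_le_centralizer.2 (hN.trans (Subgroup.center_le_centralizer _))

theorem commutator_self_le_centralizer {X Y : Subgroup G} (h : ⁅X, Y⁆ ≤ center G) :
    ⁅X, X⁆ ≤ Subgroup.centralizer Y := by
  rw [← Subgroup.commutator_eq_bot_iff_le_centralizer]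
  exact Subgroup.commutator_commutator_eq_bot_of_rotate (commutator_eq_bot_of_le_center h X)
    (commutator_eq_bot_of_le_center (by rwa [Subgroup.commutator_comm]) X)

theorem exists_mem_commutator_comap {K : Type u} [Group K] {f : K →* G} (hf : Surjective f)
    {X : Subgroup G} {g : G} (hg : g ∈ ⁅X, X⁆) : ∃ k ∈ ⁅X.comap f, X.comap f⁆, f k = g := by
  rwa [← Subgroup.map_comap_eq_self_of_surjective hf X, ← Subgroup.map_commutator] at hg

theorem commutator_inf_commutator_le_epicenter {X Y : Subgroup G} (hXY : ⁅X, Y⁆ = ⊥)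
    (hsup : X ⊔ Y = ⊤) : ⁅X, X⁆ ⊓ ⁅Y, Y⁆ ≤ epicenter G := by
  rintro g ⟨hgX, hgY⟩
  refine mem_epicenter.2 fun K _ f hf hker => ?_
  have hcomm : ⁅X.comap f, Y.comap f⁆ ≤ center K := by
    refine le_trans ?_ hker
    rw [← Subgroup.map_eq_bot_iff, Subgroup.map_commutator,
      Subgroup.map_comap_eq_self_of_surjective hf, Subgroup.map_comap_eq_self_of_surjective hf, hXY]
  obtain ⟨k, hk, rfl⟩ := exists_mem_commutator_comap hf hgX
  obtain ⟨l, hl, hlk⟩ := exists_mem_commutator_comap hf hgY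
  have hkY : Y.comap f ≤ Subgroup.centralizer {k} :=
    fun y hy => Subgroup.mem_centralizer_singleton_iff.2
      (Subgroup.mem_centralizer_iff.1 (commutator_self_le_centralizer hcomm hk) y hy)
  have hkX : X.comap f ≤ Subgroup.centralizer {k} := fun x hx => by
    have hxl : Commute x l := Subgroup.mem_centralizer_iff.1
      (commutator_self_le_centralizer (by rwa [Subgroup.commutator_comm]) hl) x hx
    have hz : l⁻¹ * k ∈ center K := hker (by simp [hlk])
    have := hxl.mul_right (mem_center_iff.1 hz x)
    rw [mul_inv_cancel_left] at this
    exact Subgroup.mem_centralizer_singleton_iff.2 this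
  refine ⟨k, ?_, rfl⟩
  have htop : X.comap f ⊔ Y.comap f = ⊤ := by
    rw [Subgroup.comap_sup_eq f X Y hf, hsup, Subgroup.comap_top]
  exact mem_center_iff.2 fun x =>
    Subgroup.mem_centralizer_singleton_iff.1 (sup_le hkX hkY (htop ▸ Subgroup.mem_top x))

end CentralProduct

namespace CentralAmalgam

variable {G₁ G₂ : Type u} [Group G₁] [Group G₂] (A : CentralAmalgam G₁ G₂)

/-- The inclusion of the first factor. -/
def inl : G₁ →* A.Product := (QuotientGroup.mk' A.kernel).comp (MonoidHom.inl G₁ G₂)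

/-- The inclusion of the second factor. -/
def inr : G₂ →* A.Product := (QuotientGroup.mk' A.kernel).comp (MonoidHom.inr G₁ G₂)

theorem inl_injective : Injective A.inl := by
  refine (injective_iff_map_eq_one _).2 fun g hg => ?_
  obtain ⟨h, hh⟩ := (QuotientGroup.eq_one_iff _).1 hg
  obtain ⟨rfl, hφ⟩ := Prod.ext_iff.1 hh
  have hφ' : A.φ h = 1 := inv_eq_one.1 hφ.symm
  exact congrArg Subtype.val ((injective_iff_map_eq_one _).1 A.φ_injective h hφ')

theorem inl_eq_inr (h : A.H) : A.inl h = A.inr (A.φ h) :=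
  QuotientGroup.eq.2 ⟨h⁻¹, by ext <;> simp⟩

theorem commutator_range_inl_range_inr : ⁅A.inl.range, A.inr.range⁆ = ⊥ := by
  refine eq_bot_iff.2 (Subgroup.commutator_le.2 ?_)
  rintro _ ⟨x, rfl⟩ _ ⟨y, rfl⟩
  exact commutatorElement_eq_one_iff_commute.2
    ((MonoidHom.commute_inl_inr x y).map (QuotientGroup.mk' A.kernel))

theorem range_inl_sup_range_inr : A.inl.range ⊔ A.inr.range = ⊤ := by
  refine eq_top_iff.2 fun z _ => ?_
  obtain ⟨⟨x, y⟩, rfl⟩ := QuotientGroup.mk'_surjective A.kernel z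
  have hxy : A.inl x * A.inr y = QuotientGroup.mk' A.kernel (x, y) := by
    simp [inl, inr, ← QuotientGroup.mk_mul]
  exact hxy ▸ Subgroup.mul_mem_sup ⟨x, rfl⟩ ⟨y, rfl⟩

variable {A}

theorem inl_mem_epicenter (h₁ : A.H ≤ commutator G₁) (h₂ : A.φ.range ≤ commutator G₂) (h : A.H) :
    A.inl h ∈ epicenter A.Product := by
  have hmap {K : Type u} [Group K] (ψ : K →* A.Product) {k : K} (hk : k ∈ commutator K) :
      ψ k ∈ ⁅ψ.range, ψ.range⁆ := by
    rw [MonoidHom.range_eq_map, ← Subgroup.map_commutator]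
    exact Subgroup.mem_map_of_mem ψ hk
  refine commutator_inf_commutator_le_epicenter A.commutator_range_inl_range_inr
    A.range_inl_sup_range_inr ⟨hmap A.inl (h₁ h.2), ?_⟩
  rw [A.inl_eq_inr]
  exact hmap A.inr (h₂ ⟨h, rfl⟩)

end CentralAmalgam

section InternalAmalgam

variable {G : Type u} [Group G]

theorem IsNonabelianCommutatorAmalgam.not_comm (h : IsNonabelianCommutatorAmalgam G) :
    ¬ ∀ x y : G, x * y = y * x := by
  obtain ⟨G₁, G₂, _, _, A, h₁, -, -, -, -, -, ⟨e⟩⟩ := h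
  refine mt (fun hc x y => A.inl_injective (e.symm.injective ?_)) h₁
  simpa only [map_mul] using hc _ _

theorem IsNonabelianCommutatorAmalgam.not_isCapable (h : IsNonabelianCommutatorAmalgam G) :
    ¬ IsCapable G := by
  obtain ⟨G₁, G₂, _, _, A, -, -, -, hne, h₁, h₂, ⟨e⟩⟩ := h
  intro hcap
  have hbot := isCapable_iff_epicenter_eq_bot.1 (hcap.of_mulEquiv e)
  obtain ⟨h, hh⟩ := Subgroup.ne_bot_iff_exists_ne_one.1 hne
  have hone : A.inl h = 1 := Subgroup.mem_bot.1 (hbot ▸ CentralAmalgam.inl_mem_epicenter h₁ h₂ h)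
  exact hh (Subtype.ext ((injective_iff_map_eq_one _).1 A.inl_injective _ hone))

namespace CentralAmalgam

variable {A B : Subgroup G} (hAB : A ≤ Subgroup.centralizer B)

/-- The amalgam of two commuting subgroups along their intersection. -/
def ofSubgroups : CentralAmalgam A B where
  H := B.subgroupOf A
  H_le_center h hh := mem_center_iff.2 fun a =>
    Subtype.ext (Subgroup.mem_centralizer_iff.1 (hAB a.2) h.1 hh).symm
  φ := (A.subtype.comp (B.subgroupOf A).subtype).codRestrict B fun h => h.2
  φ_injective _ _ h := Subtype.ext (Subtype.ext (congrArg (fun b : B => b.1) h))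
  φ_mem_center h := mem_center_iff.2 fun b =>
    Subtype.ext (Subgroup.mem_centralizer_iff.1 (hAB h.1.2) b.1 b.2)

theorem nonempty_mulEquiv_product_ofSubgroups (hsup : A ⊔ B = ⊤) :
    Nonempty (G ≃* (ofSubgroups hAB).Product) := by
  have hcomm (a : A) (b : B) : Commute (A.subtype a) (B.subtype b) :=
    (Subgroup.mem_centralizer_iff.1 (hAB a.2) b b.2).symm
  let μ : A × B →* G := MonoidHom.noncommCoprod A.subtype B.subtype hcomm
  have hμ : Surjective μ := by
    rw [← MonoidHom.range_eq_top, MonoidHom.noncommCoprod_range, A.range_subtype, B.range_subtype,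
      hsup]
  have hker : (ofSubgroups hAB).kernel = μ.ker := by
    ext ⟨a, b⟩
    constructor
    · rintro ⟨h, hh⟩
      obtain ⟨rfl, rfl⟩ := Prod.ext_iff.1 hh
      exact mul_inv_cancel h.1.1
    · intro (h : a.1 * b.1 = 1)
      have hab : a.1 = (b.1)⁻¹ := eq_inv_of_mul_eq_one_left h
      exact ⟨⟨a, show a.1 ∈ B from hab ▸ inv_mem b.2⟩,
        Prod.ext rfl (Subtype.ext (eq_inv_of_mul_eq_one_right h))⟩
  exact ⟨((QuotientGroup.quotientMulEquivOfEq hker).trans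
    (QuotientGroup.quotientKerEquivOfSurjective μ hμ)).symm⟩

end CentralAmalgam

theorem mem_commutator_subgroup {A : Subgroup G} {a : A} : a ∈ commutator A ↔ a.1 ∈ ⁅A, A⁆ := by
  have hmap : (commutator A).map A.subtype = ⁅A, A⁆ := by
    rw [commutator_def, Subgroup.map_commutator, ← MonoidHom.range_eq_map, A.range_subtype]
  exact hmap ▸ (Subgroup.mem_map_iff_mem A.subtype_injective).symm

theorem not_comm_of_mem_commutator {A : Subgroup G} {c : G} (hc : c ≠ 1) (hcA : c ∈ ⁅A, A⁆) :
    ¬ ∀ x y : A, x * y = y * x := by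
  intro h
  have hbot : ⁅A, A⁆ = ⊥ := eq_bot_iff.2 (Subgroup.commutator_le.2 fun x hx y hy =>
    commutatorElement_eq_one_iff_mul_comm.2 (congrArg Subtype.val (h ⟨x, hx⟩ ⟨y, hy⟩)))
  exact hc (Subgroup.mem_bot.1 (hbot ▸ hcA))

theorem isNonabelianCommutatorAmalgam_of_subgroups {A B : Subgroup G}
    (hAB : A ≤ Subgroup.centralizer B) (hsup : A ⊔ B = ⊤) {c : G} (hc : c ≠ 1)
    (hinf : A ⊓ B = zpowers c) (hcA : c ∈ ⁅A, A⁆) (hcB : c ∈ ⁅B, B⁆) :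
    IsNonabelianCommutatorAmalgam G := by
  have hmem (h : B.subgroupOf A) : h.1.1 ∈ zpowers c := hinf ▸ ⟨h.1.2, h.2⟩
  have hcmem : c ∈ A ⊓ B := hinf ▸ Subgroup.mem_zpowers c
  refine ⟨A, B, inferInstance, inferInstance, CentralAmalgam.ofSubgroups hAB,
    not_comm_of_mem_commutator hc hcA, not_comm_of_mem_commutator hc hcB, ?_, ?_, ?_, ?_,
    CentralAmalgam.nonempty_mulEquiv_product_ofSubgroups hAB hsup⟩
  · exact isCyclic_of_injective
      ((A.subtype.comp (B.subgroupOf A).subtype).codRestrict (zpowers c) hmem)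
      fun _ _ h => Subtype.ext (Subtype.ext (congrArg (fun z : zpowers c => z.1) h))
  · exact (Subgroup.ne_bot_iff_exists_ne_one).2 ⟨⟨⟨c, hcmem.1⟩, hcmem.2⟩, fun h => hc
      (congrArg (fun x : B.subgroupOf A => x.1.1) h)⟩
  · exact fun h hh => mem_commutator_subgroup.2 (Subgroup.zpowers_le.2 hcA (hmem ⟨h, hh⟩))
  · rintro _ ⟨h, rfl⟩
    exact mem_commutator_subgroup.2 (Subgroup.zpowers_le.2 hcB (hmem h))

end InternalAmalgam

section Trilinear

variable {F V : Type*} [Field F] [AddCommGroup V] [Module F V]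

/-- The cyclic sum `S u v w + S v w u + S w u v` of a trilinear form. -/
def cyclicSum (S : V →ₗ[F] V →ₗ[F] V →ₗ[F] F) : V →ₗ[F] V →ₗ[F] V →ₗ[F] F :=
  S + (LinearMap.lflip.toLinearMap ∘ₗ S).flip + LinearMap.lflip.toLinearMap ∘ₗ S.flip

/-- The exterior product of a bilinear form with a covector, as a trilinear form. -/
def wedgeForm (ω : V →ₗ[F] V →ₗ[F] F) (ξ : Module.Dual F V) : V →ₗ[F] V →ₗ[F] V →ₗ[F] F :=
  cyclicSum (ω.compr₂ (LinearMap.toSpanSingleton F _ ξ))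

theorem wedgeForm_apply (ω : V →ₗ[F] V →ₗ[F] F) (ξ : Module.Dual F V) (u v w : V) :
    wedgeForm ω ξ u v w = ω u v * ξ w + ω v w * ξ u + ω w u * ξ v := rfl

/-- A trilinear form that vanishes when two consecutive arguments agree. -/
structure IsAlternating (θ : V →ₗ[F] V →ₗ[F] V →ₗ[F] F) : Prop where
  left (u w : V) : θ u u w = 0
  right (u v : V) : θ u v v = 0

namespace IsAlternating

variable {θ : V →ₗ[F] V →ₗ[F] V →ₗ[F] F}

theorem swap_left (hθ : IsAlternating θ) (u v w : V) : θ u v w = -θ v u w := by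
  have h := hθ.left (u + v) w
  simp only [map_add, LinearMap.add_apply, hθ.left] at h
  linear_combination h

theorem swap_right (hθ : IsAlternating θ) (u v w : V) : θ u v w = -θ u w v :=
  (LinearMap.IsAlt.neg (hθ.right u) w v).symm

theorem outer (hθ : IsAlternating θ) (u v : V) : θ u v u = 0 := by
  rw [hθ.swap_right, hθ.left, neg_zero]

variable {θ' : V →ₗ[F] V →ₗ[F] V →ₗ[F] F} {ι : Type*} [LinearOrder ι] {e : ι → V}

theorem apply_eq_of_forall_lt (hθ : IsAlternating θ) (hθ' : IsAlternating θ')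
    (h : ∀ i j k, i < j → j < k → θ (e i) (e j) (e k) = θ' (e i) (e j) (e k)) (i j k : ι) :
    θ (e i) (e j) (e k) = θ' (e i) (e j) (e k) := by
  have of_lt {i j : ι} (hij : i < j) (k : ι) : θ (e i) (e j) (e k) = θ' (e i) (e j) (e k) := by
    rcases lt_trichotomy j k with hjk | rfl | hkj
    · exact h i j k hij hjk
    · rw [hθ.right, hθ'.right]
    rw [hθ.swap_right, hθ'.swap_right, neg_inj]
    rcases lt_trichotomy i k with hik | rfl | hki
    · exact h i k j hik hkj
    · rw [hθ.left, hθ'.left]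
    · rw [hθ.swap_left, hθ'.swap_left, h k i j hki hij]
  rcases lt_trichotomy i j with hij | rfl | hji
  · exact of_lt hij k
  · rw [hθ.left, hθ'.left]
  · rw [hθ.swap_left, hθ'.swap_left, of_lt hji]

theorem ext_of_forall_lt {r : V} (hθ : IsAlternating θ) (hθ' : IsAlternating θ')
    (hspan : Submodule.span F (insert r (Set.range e)) = ⊤) (hr : θ r = 0) (hr' : θ' r = 0)
    (h : ∀ i j k, i < j → j < k → θ (e i) (e j) (e k) = θ' (e i) (e j) (e k)) : θ = θ' := by
  refine LinearMap.ext_on hspan ?_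
  rintro _ (rfl | ⟨i, rfl⟩)
  · rw [hr, hr']
  refine LinearMap.ext_on hspan ?_
  rintro _ (rfl | ⟨j, rfl⟩)
  · ext w
    rw [hθ.swap_left, hθ'.swap_left, hr, hr']
  refine LinearMap.ext_on hspan ?_
  rintro _ (rfl | ⟨k, rfl⟩)
  · rw [hθ.swap_right, hθ'.swap_right, hθ.swap_left, hθ'.swap_left, hr, hr']
  · exact hθ.apply_eq_of_forall_lt hθ' h i j k

end IsAlternating

theorem isAlternating_wedgeForm {ω : V →ₗ[F] V →ₗ[F] F} (hω : ω.IsAlt) (ξ : Module.Dual F V) :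
    IsAlternating (wedgeForm ω ξ) where
  left u w := by
    rw [wedgeForm_apply, hω u, ← hω.neg w u]
    ring
  right u v := by
    rw [wedgeForm_apply, hω v, ← hω.neg u v]
    ring

end Trilinear

section HyperbolicQuadruple

variable {F V : Type*} [Field F] [AddCommGroup V] [Module F V]

/-- Four vectors forming two mutually orthogonal hyperbolic pairs `(e 0, e 1)` and `(e 2, e 3)` of
the form `η`. An alternating form has such a quadruple precisely when its rank exceeds two. -/
structure IsHyperbolicQuadruple (η : V →ₗ[F] V →ₗ[F] F) (e : Fin 4 → V) : Prop where
  apply_zero_one : η (e 0) (e 1) = 1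
  apply_two_three : η (e 2) (e 3) = 1
  apply_zero_two : η (e 0) (e 2) = 0
  apply_zero_three : η (e 0) (e 3) = 0
  apply_one_two : η (e 1) (e 2) = 0
  apply_one_three : η (e 1) (e 3) = 0

namespace IsHyperbolicQuadruple

variable {η : V →ₗ[F] V →ₗ[F] F} {e : Fin 4 → V}

theorem apply_eq (he : IsHyperbolicQuadruple η e) (hη : η.IsAlt) (i j : Fin 4) :
    η (e i) (e j) = !![0, 1, 0, 0; -1, 0, 0, 0; 0, 0, 0, 1; 0, 0, -1, 0] i j := by
  fin_cases i <;> fin_cases j <;> simp only [Fin.zero_eta, Fin.mk_one, Fin.reduceFinMk, hη _,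
    he.apply_zero_one, he.apply_zero_two, he.apply_zero_three, he.apply_one_two, he.apply_one_three,
    he.apply_two_three, ← hη.neg (e 0) (e 1), ← hη.neg (e 0) (e 2), ← hη.neg (e 0) (e 3),
    ← hη.neg (e 1) (e 2), ← hη.neg (e 1) (e 3), ← hη.neg (e 2) (e 3)] <;> simp

theorem exists_mem_span_forall_apply_eq (he : IsHyperbolicQuadruple η e) (hη : η.IsAlt)
    (x : Fin 4 → F) : ∃ v ∈ Submodule.span F (Set.range e), ∀ i, η (e i) v = x i := by
  have hmem (i : Fin 4) : e i ∈ Submodule.span F (Set.range e) := Submodule.subset_span ⟨i, rfl⟩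
  refine ⟨x 0 • e 1 - x 1 • e 0 + (x 2 • e 3 - x 3 • e 2),
    add_mem (sub_mem (Submodule.smul_mem _ _ (hmem 1)) (Submodule.smul_mem _ _ (hmem 0)))
      (sub_mem (Submodule.smul_mem _ _ (hmem 3)) (Submodule.smul_mem _ _ (hmem 2))), fun i => ?_⟩
  fin_cases i <;> simp [he.apply_eq hη]

theorem exists_radical_vector [FiniteDimensional F V] (he : IsHyperbolicQuadruple η e)
    (hη : η.IsAlt) (hdim : Module.finrank F V ≤ 5) :
    ∃ r, η r = 0 ∧ Submodule.span F (insert r (Set.range e)) = ⊤ := by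
  let φ : V →ₗ[F] Fin 4 → F := LinearMap.pi fun i => η (e i)
  have hφ : Surjective φ := fun x => by
    obtain ⟨v, -, hv⟩ := he.exists_mem_span_forall_apply_eq hη x
    exact ⟨v, funext hv⟩
  have hker : Module.finrank F (LinearMap.ker φ) ≤ 1 := by
    have h := LinearMap.finrank_range_add_finrank_ker φ
    rw [LinearMap.range_eq_top.2 hφ, finrank_top, Module.finrank_fin_fun] at h
    lia
  obtain ⟨⟨r, hr⟩, hr'⟩ := finrank_le_one_iff.1 hker
  have hspan : Submodule.span F (insert r (Set.range e)) = ⊤ := by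
    refine eq_top_iff.2 fun v _ => ?_
    obtain ⟨v', hv', hφv⟩ := he.exists_mem_span_forall_apply_eq hη (φ v)
    have hsub : v - v' ∈ LinearMap.ker φ := by
      rw [LinearMap.mem_ker, map_sub, sub_eq_zero]
      exact (funext hφv).symm
    obtain ⟨k, hk⟩ := hr' ⟨_, hsub⟩
    exact Submodule.mem_span_insert.2
      ⟨k, v', hv', sub_eq_iff_eq_add.1 (congrArg Subtype.val hk).symm⟩
  refine ⟨r, LinearMap.ext_on hspan ?_, hspan⟩
  rintro _ (rfl | ⟨i, rfl⟩)
  · exact hη _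
  · rw [← hη.neg]
    exact neg_eq_zero.2 (congrFun (LinearMap.mem_ker.1 hr) i)

theorem exists_eq_wedgeForm (he : IsHyperbolicQuadruple η e) (hη : η.IsAlt) {r : V}
    (hr : η r = 0) (hspan : Submodule.span F (insert r (Set.range e)) = ⊤)
    {θ : V →ₗ[F] V →ₗ[F] V →ₗ[F] F} (hθ : IsAlternating θ) (hθr : θ r = 0) :
    ∃ ξ, θ = wedgeForm η ξ := by
  let ξ : Module.Dual F V := (θ.flip (e 2)).flip (e 3) + θ (e 0) (e 1)
  have hξ (w : V) : ξ w = θ w (e 2) (e 3) + θ (e 0) (e 1) w := rfl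
  refine ⟨ξ, hθ.ext_of_forall_lt (isAlternating_wedgeForm hη ξ) hspan hθr ?_ ?_⟩
  · have hξr : ξ r = 0 := by simp [hξ, hθr, hθ.swap_right _ _ r, hθ.swap_left _ r]
    ext v w
    simp [wedgeForm_apply, hr, hξr, ← hη.neg r w]
  · intro i j k hij hjk
    fin_cases i <;> fin_cases j <;> fin_cases k <;> first
      | exact absurd hij (by decide)
      | exact absurd hjk (by decide)
      | simp [wedgeForm_apply, hξ, he.apply_eq hη, hθ.left, hθ.right, hθ.outer]

theorem exists_wedgeForm_eq_wedgeForm [FiniteDimensional F V] (he : IsHyperbolicQuadruple η e)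
    (hη : η.IsAlt) (hdim : Module.finrank F V ≤ 5) {ω : V →ₗ[F] V →ₗ[F] F} (hω : ω.IsAlt) :
    ∃ ξ ≠ 0, ∃ ξ', wedgeForm ω ξ = wedgeForm η ξ' := by
  obtain ⟨r, hr, hspan⟩ := he.exists_radical_vector hη hdim
  obtain ⟨ξ, hξ, hξr, k, hk⟩ : ∃ ξ : Module.Dual F V, ξ ≠ 0 ∧ ξ r = 0 ∧ ∃ k : F, ω r = k • ξ := by
    rcases eq_or_ne (ω r) 0 with h | h
    · refine ⟨η (e 0), fun h0 => ?_, by rw [← hη.neg, hr]; simp, 0, by rw [h, zero_smul]⟩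
      simpa [h0] using he.apply_zero_one
    · exact ⟨ω r, h, hω r, 1, (one_smul F _).symm⟩
  refine ⟨ξ, hξ, he.exists_eq_wedgeForm hη hr hspan (isAlternating_wedgeForm hω ξ) ?_⟩
  ext v w
  simp only [wedgeForm_apply, hξr, ← hω.neg r w, hk, LinearMap.smul_apply, smul_eq_mul,
    LinearMap.zero_apply]
  ring

end IsHyperbolicQuadruple

end HyperbolicQuadruple

section DecomposableForm

variable {F V : Type*} [Field F] [AddCommGroup V] [Module F V]

/-- The exterior product `a ∧ u` of two covectors, as a bilinear form. -/
def wedge (a : Module.Dual F V) : Module.Dual F V →ₗ[F] V →ₗ[F] V →ₗ[F] F where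
  toFun u := a.smulRight u - u.smulRight a
  map_add' _ _ := by ext; simp; ring
  map_smul' _ _ := by ext; simp; ring

theorem wedge_apply_apply (a u : Module.Dual F V) (s t : V) :
    wedge a u s t = a s * u t - u s * a t := rfl

theorem wedge_self (a : Module.Dual F V) : wedge a a = 0 := by
  ext
  simp [wedge_apply_apply]

theorem wedge_comm (a u : Module.Dual F V) : wedge a u = (-1 : F) • wedge u a := by
  ext
  simp [wedge_apply_apply]

theorem mem_span_singleton_of_wedge_eq_zero {a u : Module.Dual F V} (ha : a ≠ 0)
    (h : wedge a u = 0) : u ∈ Submodule.span F {a} := by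
  obtain ⟨s, hs⟩ := LinearMap.surjective ha 1
  refine Submodule.mem_span_singleton.2 ⟨u s, LinearMap.ext fun t => ?_⟩
  have hst := LinearMap.congr_fun₂ h s t
  rw [wedge_apply_apply, hs, one_mul] at hst
  exact (sub_eq_zero.1 hst).symm

/-- A bilinear form is decomposable if it is the exterior product of two covectors, that is, if it
is alternating of rank at most two. -/
def IsDecomposable (η : V →ₗ[F] V →ₗ[F] F) : Prop := ∃ a u, wedge a u = η

namespace IsDecomposable

variable {η : V →ₗ[F] V →ₗ[F] F}

theorem isAlt (hη : IsDecomposable η) : η.IsAlt := by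
  obtain ⟨a, u, rfl⟩ := hη
  intro v
  rw [wedge_apply_apply, mul_comm, sub_self]

theorem wedge_apply_eq_smul (hη : IsDecomposable η) (s t : V) :
    wedge (η s) (η t) = η s t • η := by
  obtain ⟨a, u, rfl⟩ := hη
  ext v w
  simp only [wedge_apply_apply, LinearMap.smul_apply, smul_eq_mul]
  ring

end IsDecomposable

theorem isDecomposable_or_exists_isHyperbolicQuadruple {η : V →ₗ[F] V →ₗ[F] F} (hη : η.IsAlt) :
    IsDecomposable η ∨ ∃ e, IsHyperbolicQuadruple η e := by
  refine or_iff_not_imp_left.2 fun hdec => ?_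
  obtain ⟨x, hx⟩ : ∃ x, η x ≠ 0 := by
    by_contra! h
    exact hdec ⟨0, 0, (map_zero _).trans (LinearMap.ext h).symm⟩
  obtain ⟨y, hxy⟩ := LinearMap.surjective hx 1
  have hyx : η y x = -1 := by rw [← hη.neg, hxy]
  obtain ⟨u, v, huv⟩ : ∃ u v, η u v - wedge (η x) (η y) u v ≠ 0 := by
    by_contra! h
    exact hdec ⟨η x, η y, (LinearMap.ext₂ fun u v => sub_eq_zero.1 (h u v)).symm⟩
  obtain ⟨δ, hδ⟩ : ∃ δ, δ = η u v - wedge (η x) (η y) u v := ⟨_, rfl⟩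
  rw [← hδ] at huv
  refine ⟨![x, y, u + η y u • x - η x u • y, δ⁻¹ • (v + η y v • x - η x v • y)], ?_⟩
  constructor
  · exact hxy
  · change η (u + η y u • x - η x u • y) (δ⁻¹ • (v + η y v • x - η x v • y)) = 1
    rw [map_smul, smul_eq_mul, inv_mul_eq_one₀ huv, hδ]
    simp only [map_add, map_sub, map_smul, LinearMap.add_apply, LinearMap.sub_apply,
      LinearMap.smul_apply, smul_eq_mul, wedge_apply_apply, hη _, hxy, hyx, ← hη.neg x u,
      ← hη.neg y u]
    ring
  all_goals simp [hη _, hxy, hyx]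

/-- The covectors `u` with `a ∧ u ∈ Y`. -/
def wedgeComap (Y : Submodule F (V →ₗ[F] V →ₗ[F] F)) (a : Module.Dual F V) :
    Submodule F (Module.Dual F V) := Y.comap (wedge a)

section WedgeComap

variable {Y : Submodule F (V →ₗ[F] V →ₗ[F] F)} {a : Module.Dual F V}

theorem self_mem_wedgeComap : a ∈ wedgeComap Y a := by
  rw [wedgeComap, Submodule.mem_comap, wedge_self]
  exact Y.zero_mem

theorem mem_wedgeComap_comm {u : Module.Dual F V} : u ∈ wedgeComap Y a ↔ a ∈ wedgeComap Y u := by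
  rw [wedgeComap, wedgeComap, Submodule.mem_comap, Submodule.mem_comap, wedge_comm a]
  exact Y.smul_mem_iff (neg_ne_zero.2 one_ne_zero)

variable {η : V →ₗ[F] V →ₗ[F] F} {v : V} (hY : ∀ η ∈ Y, IsDecomposable η)
include hY

theorem apply_mem_wedgeComap_apply (hη : η ∈ Y) (s t : V) : η t ∈ wedgeComap Y (η s) := by
  rw [wedgeComap, Submodule.mem_comap, (hY η hη).wedge_apply_eq_smul]
  exact Y.smul_mem _ hη

theorem notMem_span_apply_of_forall_wedgeComap (hv : ∀ u ∈ wedgeComap Y a, u v = 0) (hη : η ∈ Y)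
    (hηv : η v ≠ 0) : a ∉ Submodule.span F {η v} := by
  refine fun ha => hηv (LinearMap.ext fun w => ?_)
  obtain ⟨k, rfl⟩ := Submodule.mem_span_singleton.1 ha
  have hw : η w ∈ wedgeComap Y (k • η v) := mem_wedgeComap_comm.2
    ((wedgeComap Y (η w)).smul_mem k (apply_mem_wedgeComap_apply hY hη w v))
  rw [← (hY η hη).isAlt.neg, hv _ hw, neg_zero, LinearMap.zero_apply]

theorem wedgeComap_le_span_pair (hv : ∀ u ∈ wedgeComap Y a, u v = 0) (hη : η ∈ Y) (hηv : η v ≠ 0) :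
    wedgeComap Y a ≤ Submodule.span F {η v, a} := by
  intro u hu
  obtain ⟨w, hvw⟩ := LinearMap.surjective hηv 1
  have hav : a v = 0 := hv a self_mem_wedgeComap
  have huv : u v = 0 := hv u hu
  have ha : a - a w • η v ≠ 0 := fun h => notMem_span_apply_of_forall_wedgeComap hY hv hη hηv
    (Submodule.mem_span_singleton.2 ⟨a w, (sub_eq_zero.1 h).symm⟩)
  have hzero : wedge (a - a w • η v) (u - u w • η v) = 0 := by
    -- Compare the Plücker relations of `η` and of `η + a ∧ u` at `v, w`.
    have hsum := (hY _ (Y.add_mem hη hu)).wedge_apply_eq_smul v w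
    have hη' := (hY η hη).wedge_apply_eq_smul v w
    ext s t
    have hsum' := LinearMap.congr_fun₂ hsum s t
    have hη'' := LinearMap.congr_fun₂ hη' s t
    simp only [wedge_apply_apply, LinearMap.add_apply, LinearMap.sub_apply, LinearMap.smul_apply,
      LinearMap.zero_apply, smul_eq_mul, hav, huv, hvw] at hsum' hη'' ⊢
    linear_combination hη'' - hsum'
  obtain ⟨k, hk⟩ := Submodule.mem_span_singleton.1 (mem_span_singleton_of_wedge_eq_zero ha hzero)
  refine Submodule.mem_span_pair.2 ⟨u w - k * a w, k, ?_⟩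
  linear_combination (norm := module) hk

theorem exists_mem_wedgeComap_notMem_span_pair (hv : ∀ u ∈ wedgeComap Y a, u v = 0) (hη : η ∈ Y)
    (hηv : η v ≠ 0) : ∃ z ∈ wedgeComap Y (η v), z ∉ Submodule.span F {η v, a} := by
  obtain ⟨w, hvw⟩ := LinearMap.surjective hηv 1
  refine ⟨η w, apply_mem_wedgeComap_apply hY hη v w, fun hw => ?_⟩
  obtain ⟨k, l, hkl⟩ := Submodule.mem_span_pair.1 hw
  have h := LinearMap.congr_fun hkl v
  simp [(hY η hη).isAlt v, hv a self_mem_wedgeComap, ← (hY η hη).isAlt.neg v w, hvw] at h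

theorem exists_wedgeComap_cuts_radical (hne : Y ≠ ⊥) :
    ∃ a ≠ 0, ∀ v, (∀ u ∈ wedgeComap Y a, u v = 0) → ∀ η ∈ Y, η v = 0 := by
  by_contra! hcon
  obtain ⟨θ, hθ, hθ0⟩ := Submodule.exists_mem_ne_zero_of_ne_bot hne
  obtain ⟨p, hp⟩ : ∃ p, θ p ≠ 0 := by
    by_contra! h
    exact hθ0 (LinearMap.ext h)
  obtain ⟨q, hpq⟩ := LinearMap.surjective hp 1
  have hq : θ q ∉ Submodule.span F {θ p} := fun h => by
    obtain ⟨k, hk⟩ := Submodule.mem_span_singleton.1 h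
    have hkp := LinearMap.congr_fun hk p
    simp [(hY θ hθ).isAlt p, ← (hY θ hθ).isAlt.neg p q, hpq] at hkp
  obtain ⟨v, hv, η, hη, hηv⟩ := hcon (θ p) hp
  obtain ⟨v', hv', η', hη', hηv'⟩ := hcon (η v) hηv
  have hmem : η v ∈ wedgeComap Y (θ p) := by
    refine Submodule.span_le.2 ?_ (mem_span_insert_exchange
      (wedgeComap_le_span_pair hY hv hη hηv (apply_mem_wedgeComap_apply hY hθ p q)) hq)
    rintro _ (rfl | rfl)
    · exact apply_mem_wedgeComap_apply hY hθ p q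
    · exact self_mem_wedgeComap
  have hle := wedgeComap_le_span_pair hY hv' hη' hηv'
  have hexchange : η' v' ∈ Submodule.span F {θ p, η v} := mem_span_insert_exchange
    (hle (mem_wedgeComap_comm.1 hmem)) (notMem_span_apply_of_forall_wedgeComap hY hv hη hηv)
  obtain ⟨z, hz, hz'⟩ := exists_mem_wedgeComap_notMem_span_pair hY hv hη hηv
  refine hz' (Submodule.span_le.2 ?_ (hle hz))
  rintro _ (rfl | rfl)
  · rwa [Set.pair_comm, SetLike.mem_coe]
  · exact Submodule.subset_span (Set.mem_insert _ _)

end WedgeComap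

end DecomposableForm

section Jacobi

variable {F V C : Type*} [Field F] [AddCommGroup V] [Module F V] [AddCommGroup C] [Module F C]

/-- The Jacobi identity for a map `T : C → V*` relative to the bracket `b : V × V → C`. If `b` is
the commutator pairing of a group of class two, the solutions `T` with `T c ≠ 0` give rise to
central extensions in which no lift of `c` is central. -/
def IsJacobi (b : V →ₗ[F] V →ₗ[F] C) (T : C →ₗ[F] V →ₗ[F] F) : Prop :=
  ∀ u v w, T (b u v) w + T (b v w) u + T (b w u) v = 0

/-- The bilinear form `ω ∘ b` attached to a functional `ω`, as a linear map in `ω`. -/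
def formMap (b : V →ₗ[F] V →ₗ[F] C) : Module.Dual F C →ₗ[F] V →ₗ[F] V →ₗ[F] F where
  toFun ω := b.compr₂ ω
  map_add' _ _ := rfl
  map_smul' _ _ := rfl

/-- The bilinear forms `ω ∘ b` with `ω c = 0`. -/
def formsVanishing (b : V →ₗ[F] V →ₗ[F] C) (c : C) : Submodule F (V →ₗ[F] V →ₗ[F] F) :=
  (LinearMap.ker (Module.Dual.eval F C c)).map (formMap b)

variable {b : V →ₗ[F] V →ₗ[F] C} {c : C}

theorem formMap_apply_apply (ω : Module.Dual F C) (u v : V) : formMap b ω u v = ω (b u v) := rfl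

theorem isAlt_formMap (hb : b.IsAlt) (ω : Module.Dual F C) : (formMap b ω).IsAlt := fun v => by
  rw [formMap_apply_apply, hb, map_zero]

theorem exists_dual_eq_one {D : Submodule F C} (hc : c ∉ D) :
    ∃ ω : Module.Dual F C, ω c = 1 ∧ ∀ d ∈ D, ω d = 0 := by
  obtain ⟨f, hf, hD⟩ := Submodule.exists_le_ker_of_notMem hc
  exact ⟨(f c)⁻¹ • f, by simp [hf], fun d hd => by simp [LinearMap.mem_ker.1 (hD hd)]⟩

theorem exists_dual_eq_one_of_ne_zero (hc : c ≠ 0) : ∃ ω : Module.Dual F C, ω c = 1 :=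
  (exists_dual_eq_one (D := ⊥) (by rwa [Submodule.mem_bot])).imp fun _ h => h.1

theorem mem_span_of_forall_formsVanishing {v : V} (h : ∀ η ∈ formsVanishing b c, η v = 0) (u : V) :
    b v u ∈ Submodule.span F {c} := by
  by_contra hn
  obtain ⟨ω, h1, h0⟩ := exists_dual_eq_one hn
  have hω : formMap b ω ∈ formsVanishing b c :=
    Submodule.mem_map_of_mem (h0 c (Submodule.mem_span_singleton_self c))
  exact one_ne_zero (h1.symm.trans (LinearMap.congr_fun (h _ hω) u))

theorem exists_lift_of_forall_mem_formsVanishing {f : V →ₗ[F] V →ₗ[F] V →ₗ[F] F}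
    (hf : ∀ w, f w ∈ formsVanishing b c) :
    ∃ S : V →ₗ[F] Module.Dual F C, ∀ w, S w c = 0 ∧ formMap b (S w) = f w := by
  obtain ⟨S, hS⟩ := Module.projective_lifting_property
    ((formMap b).submoduleMap (LinearMap.ker (Module.Dual.eval F C c))) (f.codRestrict _ hf)
    ((formMap b).submoduleMap_surjective _)
  exact ⟨Submodule.subtype _ ∘ₗ S, fun w =>
    ⟨(S w).2, congrArg Subtype.val (LinearMap.congr_fun hS w)⟩⟩

theorem exists_sub_flip_eq_of_isotropic {B : V →ₗ[F] V →ₗ[F] F} (h2 : (2 : F) ≠ 0) (hB : B.IsAlt)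
    {R : Submodule F V} (hR : ∀ u ∈ R, ∀ v ∈ R, B u v = 0) :
    ∃ x : V →ₗ[F] V →ₗ[F] F, (∀ v w, x v w - x w v = B v w) ∧ ∀ w, ∀ v ∈ R, x w v = 0 := by
  obtain ⟨R', hR'⟩ := R.exists_isCompl
  let π : V →ₗ[F] V := R'.subtype ∘ₗ Submodule.projectionOnto R' R hR'.symm
  have hπR (v : V) (hv : v ∈ R) : π v = 0 :=
    congrArg Subtype.val ((Submodule.projectionOnto_apply_eq_zero_iff hR'.symm).2 hv)
  have hsub (v : V) : v - π v ∈ R := by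
    rw [← Submodule.projectionOnto_apply_eq_zero_iff hR'.symm, map_sub, sub_eq_zero]
    exact (Submodule.projectionOnto_apply_left hR'.symm _).symm
  let x : V →ₗ[F] V →ₗ[F] F := B.compl₂ π - (2⁻¹ : F) • B.compl₁₂ π π
  have hx (w v : V) : x w v = B w (π v) - 2⁻¹ * B (π w) (π v) := rfl
  refine ⟨x, fun v w => ?_, fun w v hv => ?_⟩
  · have h := hR _ (hsub v) _ (hsub w)
    simp only [map_sub, LinearMap.sub_apply] at h
    rw [hx, hx, ← hB.neg (π v) w, ← hB.neg (π v) (π w)]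
    field_simp
    linear_combination -2 * h
  · rw [hx, hπR v hv, map_zero, map_zero, mul_zero, sub_zero]

theorem exists_isJacobi_of_isotropic (h2 : (2 : F) ≠ 0) (hb : b.IsAlt) {ω : Module.Dual F C}
    (hω : ω c = 1) {R : Submodule F V} (hR : ∀ u ∈ R, ∀ v ∈ R, ω (b u v) = 0)
    {a : Module.Dual F V} (ha : R.dualAnnihilator ≤ wedgeComap (formsVanishing b c) a) :
    ∃ T, IsJacobi b T ∧ T c = a := by
  obtain ⟨x, hx, hxR⟩ := exists_sub_flip_eq_of_isotropic h2 (isAlt_formMap hb ω) hR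
  obtain ⟨S, hS⟩ := exists_lift_of_forall_mem_formsVanishing (f := wedge a ∘ₗ x) fun w =>
    ha ((Submodule.mem_dualAnnihilator _).2 (hxR w))
  have hSb (u v w : V) : S w (b u v) = a u * x w v - x w u * a v :=
    LinearMap.congr_fun₂ (hS w).2 u v
  refine ⟨ω.smulRight a + S.flip, fun u v w => ?_, ?_⟩
  · simp only [formMap_apply_apply] at hx
    simp only [LinearMap.add_apply, LinearMap.smulRight_apply, LinearMap.flip_apply,
      LinearMap.smul_apply, smul_eq_mul, hSb]
    linear_combination -a u * hx v w - a v * hx w u - a w * hx u v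
  · ext v
    simp [hω, (hS v).1]

variable (hT : ∀ T, IsJacobi b T → T c = 0)
include hT

theorem isDecomposable_of_mem_formsVanishing [FiniteDimensional F V] (hdim : Module.finrank F V ≤ 5)
    (hb : b.IsAlt) (hc : c ≠ 0) {η : V →ₗ[F] V →ₗ[F] F} (hη : η ∈ formsVanishing b c) :
    IsDecomposable η := by
  obtain ⟨φ, hφ, rfl⟩ := hη
  refine (isDecomposable_or_exists_isHyperbolicQuadruple (isAlt_formMap hb φ)).resolve_right ?_
  rintro ⟨e, he⟩
  obtain ⟨ω, hω⟩ := exists_dual_eq_one_of_ne_zero (F := F) hc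
  obtain ⟨ξ, hξ, ξ', h⟩ :=
    he.exists_wedgeForm_eq_wedgeForm (isAlt_formMap hb φ) hdim (isAlt_formMap hb ω)
  have hJ : IsJacobi b (ω.smulRight ξ - φ.smulRight ξ') := fun u v w => by
    have huvw := LinearMap.congr_fun (LinearMap.congr_fun₂ h u v) w
    simp only [wedgeForm_apply, formMap_apply_apply] at huvw
    simp only [LinearMap.sub_apply, LinearMap.smulRight_apply, LinearMap.smul_apply, smul_eq_mul]
    linear_combination huvw
  apply hξ
  simpa [hω, show φ c = 0 from hφ] using hT _ hJ

theorem exists_bracket_ne_zero [FiniteDimensional F V] (h2 : (2 : F) ≠ 0)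
    (hdim : Module.finrank F V ≤ 5) (hb : b.IsAlt) (hc : c ≠ 0) (hspan : c ∈ Submodule.map₂ b ⊤ ⊤) :
    ∃ v₁ v₂, b v₁ v₂ ≠ 0 ∧ (∀ u, b v₁ u ∈ Submodule.span F {c}) ∧
      ∀ u, b v₂ u ∈ Submodule.span F {c} := by
  let R : Submodule F V := LinearMap.ker (b.compr₂ (Submodule.span F {c}).mkQ)
  have mem_R (v : V) : v ∈ R ↔ ∀ u, b v u ∈ Submodule.span F {c} := by
    simp only [R, LinearMap.mem_ker, LinearMap.ext_iff, LinearMap.compr₂_apply,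
      Submodule.mkQ_apply, LinearMap.zero_apply, Submodule.Quotient.mk_eq_zero]
  by_contra! hcon
  have hR : ∀ u ∈ R, ∀ v ∈ R, b u v = 0 := fun u hu v hv => by
    by_contra hne
    obtain ⟨w, hw⟩ := hcon u v hne ((mem_R u).1 hu)
    exact hw ((mem_R v).1 hv w)
  have hne : formsVanishing b c ≠ ⊥ := fun h => by
    have hRtop (v : V) : v ∈ R := (mem_R v).2
      (mem_span_of_forall_formsVanishing fun η hη => by
        simp [(Submodule.eq_bot_iff _).1 h η hη])
    have hle : Submodule.map₂ b ⊤ ⊤ ≤ ⊥ := Submodule.map₂_le.2 fun u _ v _ =>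
      (Submodule.mem_bot F).2 (hR u (hRtop u) v (hRtop v))
    exact hc ((Submodule.mem_bot F).1 (hle hspan))
  obtain ⟨a, ha, hcut⟩ := exists_wedgeComap_cuts_radical
    (fun η hη => isDecomposable_of_mem_formsVanishing hT hdim hb hc hη) hne
  have hann : R.dualAnnihilator ≤ wedgeComap (formsVanishing b c) a := by
    rw [← Subspace.dualCoannihilator_dualAnnihilator_eq (W := wedgeComap (formsVanishing b c) a)]
    exact Submodule.dualAnnihilator_anti fun v hv => (mem_R v).2
      (mem_span_of_forall_formsVanishing (hcut v ((Submodule.mem_dualCoannihilator v).1 hv)))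
  obtain ⟨ω, hω⟩ := exists_dual_eq_one_of_ne_zero (F := F) hc
  obtain ⟨T, hJ, hTc⟩ := exists_isJacobi_of_isotropic h2 hb hω
    (fun u hu v hv => by rw [hR u hu v hv, map_zero]) hann
  exact ha (hTc.symm.trans (hT T hJ))

theorem exists_bracket_eq [FiniteDimensional F V] (h2 : (2 : F) ≠ 0)
    (hdim : Module.finrank F V ≤ 5) (hb : b.IsAlt) (hc : c ≠ 0) (hspan : c ∈ Submodule.map₂ b ⊤ ⊤) :
    ∃ v₁ v₂, b v₁ v₂ = c ∧ (∀ u, b v₁ u ∈ Submodule.span F {c}) ∧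
      ∀ u, b v₂ u ∈ Submodule.span F {c} := by
  obtain ⟨v₁, v₂, hne, h₁, h₂⟩ := exists_bracket_ne_zero hT h2 hdim hb hc hspan
  obtain ⟨k, hk⟩ := Submodule.mem_span_singleton.1 (h₁ v₂)
  have hk0 : k ≠ 0 := fun h => hne (by rw [← hk, h, zero_smul])
  refine ⟨v₁, k⁻¹ • v₂, by rw [map_smul, ← hk, inv_smul_smul₀ hk0], h₁, fun u => ?_⟩
  rw [map_smul, LinearMap.smul_apply]
  exact Submodule.smul_mem _ _ (h₂ u)

theorem mem_map₂_ker_inf_ker (hb : b.IsAlt) {v₁ v₂ : V} (h₁₂ : b v₁ v₂ = c)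
    (h₁ : ∀ u, b v₁ u ∈ Submodule.span F {c}) (h₂ : ∀ u, b v₂ u ∈ Submodule.span F {c}) :
    c ∈ Submodule.map₂ b (LinearMap.ker (b v₁) ⊓ LinearMap.ker (b v₂))
      (LinearMap.ker (b v₁) ⊓ LinearMap.ker (b v₂)) := by
  by_contra hn
  obtain ⟨ω, hω, hω0⟩ := exists_dual_eq_one hn
  have eq_smul {d : C} (hd : d ∈ Submodule.span F {c}) : ω d • c = d := by
    obtain ⟨k, rfl⟩ := Submodule.mem_span_singleton.1 hd
    rw [map_smul, hω, smul_eq_mul, mul_one]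
  have h₂₁ : b v₂ v₁ = -c := by rw [← hb.neg, h₁₂]
  have hperp (u : V) : u + ω (b v₂ u) • v₁ - ω (b v₁ u) • v₂ ∈
      LinearMap.ker (b v₁) ⊓ LinearMap.ker (b v₂) := by
    constructor
    · simp [hb _, h₁₂, eq_smul (h₁ u)]
    · simp [hb _, h₂₁, eq_smul (h₂ u)]
  have hωb (u v : V) : ω (b u v) = ω (b v₁ u) * ω (b v₂ v) - ω (b v₁ v) * ω (b v₂ u) := by
    have h0 := hω0 _ (Submodule.apply_mem_map₂ b (hperp u) (hperp v))
    simp only [map_add, map_sub, map_smul, LinearMap.add_apply, LinearMap.sub_apply,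
      LinearMap.smul_apply, smul_eq_mul, hb _, h₁₂, h₂₁, map_zero, ← hb.neg v₁ u, ← hb.neg v₂ u,
      map_neg, hω] at h0
    linear_combination h0
  have hJ : IsJacobi b (ω.smulRight (ω ∘ₗ b v₁)) := fun u v w => by
    simp only [LinearMap.smulRight_apply, LinearMap.smul_apply, LinearMap.comp_apply, smul_eq_mul]
    rw [hωb u v, hωb v w, hωb w u]
    ring
  have h := LinearMap.congr_fun (hT _ hJ) v₂
  simp [hω, h₁₂] at h

end Jacobi

section TensorLift

variable {R V ι : Type*} [CommRing R] [AddCommGroup V] [Module R V] [LinearOrder ι]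

/-- The coefficients, in an ordered basis `β`, of a trilinear form whose values on the double
brackets `[[u, v], w]` of the tensor algebra are those of `S`. -/
noncomputable def tensorLiftCoeff (β : Module.Basis ι R V) (S : V →ₗ[R] V →ₗ[R] V →ₗ[R] R)
    (i j k : ι) : R :=
  if i < j ∧ i < k then S (β i) (β j) (β k) else if i = j ∧ i < k then S (β k) (β i) (β i) else 0

variable {β : Module.Basis ι R V} {S : V →ₗ[R] V →ₗ[R] V →ₗ[R] R} {i j k : ι}

theorem tensorLiftCoeff_of_lt (hij : i < j) (hik : i < k) :
    tensorLiftCoeff β S i j k = S (β i) (β j) (β k) := if_pos ⟨hij, hik⟩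

theorem tensorLiftCoeff_self_left (hik : i < k) :
    tensorLiftCoeff β S i i k = S (β k) (β i) (β i) := by simp [tensorLiftCoeff, hik]

theorem tensorLiftCoeff_of_gt (hji : j < i) : tensorLiftCoeff β S i j k = 0 := by
  simp [tensorLiftCoeff, hji.ne', hji.not_gt]

theorem tensorLiftCoeff_of_le (hki : k ≤ i) : tensorLiftCoeff β S i j k = 0 := by
  simp [tensorLiftCoeff, hki.not_gt]

theorem tensorLiftCoeff_bracket (halt : ∀ u w, S u u w = 0)
    (hjac : ∀ u v w, S u v w + S v w u + S w u v = 0) (i j k : ι) :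
    tensorLiftCoeff β S i j k - tensorLiftCoeff β S j i k - tensorLiftCoeff β S k i j +
      tensorLiftCoeff β S k j i = S (β i) (β j) (β k) := by
  have hswap (u v w : V) : S u v w = -S v u w := by
    have h := halt (u + v) w
    simp only [map_add, LinearMap.add_apply, halt, zero_add, add_zero] at h
    exact eq_neg_of_add_eq_zero_right h
  have hcyc := hjac (β i) (β j) (β k)
  have hij' := hswap (β i) (β j) (β k)
  have hjk' := hswap (β j) (β k) (β i)
  rcases lt_trichotomy i j with hij | rfl | hji
  · rcases lt_trichotomy i k with hik | rfl | hki
    · rw [tensorLiftCoeff_of_lt hij hik, tensorLiftCoeff_of_gt hij, tensorLiftCoeff_of_gt hik,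
        tensorLiftCoeff_of_le hik.le]
      ring
    · rw [tensorLiftCoeff_of_le le_rfl, tensorLiftCoeff_of_gt hij, tensorLiftCoeff_self_left hij]
      linear_combination -hij'
    · rw [tensorLiftCoeff_of_le hki.le, tensorLiftCoeff_of_gt hij,
        tensorLiftCoeff_of_lt hki (hki.trans hij), tensorLiftCoeff_of_lt (hki.trans hij) hki]
      linear_combination -hcyc + hjk'
  · rw [halt]
    ring
  · rcases lt_trichotomy j k with hjk | rfl | hkj
    · rw [tensorLiftCoeff_of_gt hji, tensorLiftCoeff_of_lt hji hjk, tensorLiftCoeff_of_le hjk.le,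
        tensorLiftCoeff_of_gt hjk]
      linear_combination -hij'
    · rw [tensorLiftCoeff_of_gt hji, tensorLiftCoeff_of_le le_rfl, tensorLiftCoeff_self_left hji]
      ring
    · rw [tensorLiftCoeff_of_gt hji, tensorLiftCoeff_of_le hkj.le,
        tensorLiftCoeff_of_lt (hkj.trans hji) hkj, tensorLiftCoeff_of_lt hkj (hkj.trans hji)]
      linear_combination -hcyc + hjk'

theorem exists_tensor_lift [Module.Free R V] (halt : ∀ u w, S u u w = 0)
    (hjac : ∀ u v w, S u v w + S v w u + S w u v = 0) :
    ∃ τ : V →ₗ[R] V →ₗ[R] V →ₗ[R] R, ∀ u v w, τ u v w - τ v u w - τ w u v + τ w v u = S u v w := by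
  let β := Module.Free.chooseBasis R V
  classical
  let := linearOrderOfSTO (WellOrderingRel (α := Module.Free.ChooseBasisIndex R V))
  let τ : V →ₗ[R] V →ₗ[R] V →ₗ[R] R :=
    β.constr R fun i => β.constr R fun j => β.constr R fun k => tensorLiftCoeff β S i j k
  have hτ (i j k) : τ (β i) (β j) (β k) = tensorLiftCoeff β S i j k := by simp [τ]
  let σ : V →ₗ[R] V →ₗ[R] V →ₗ[R] R := LinearMap.lflip.toLinearMap ∘ₗ τ.flip
  have hσ (u v w) : σ u v w = τ w u v := rfl
  have hsum : τ + σ.flip = S + τ.flip + σ := by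
    refine β.ext fun i => β.ext fun j => β.ext fun k => ?_
    simp only [LinearMap.add_apply, LinearMap.flip_apply, hσ, hτ]
    linear_combination tensorLiftCoeff_bracket (β := β) halt hjac i j k
  refine ⟨τ, fun u v w => ?_⟩
  have h := LinearMap.congr_fun (LinearMap.congr_fun₂ hsum u v) w
  simp only [LinearMap.add_apply, LinearMap.flip_apply, hσ] at h
  linear_combination h

end TensorLift

section ClassTwo

variable {G : Type u} [Group G]

/-- The commutator of a group of class at most two as a bimultiplicative map to the center. -/
def commutatorHom (hG : commutator G ≤ center G) : G →* G →* center G :=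
  have mem_center (x y : G) : ⁅x, y⁆ ∈ center G :=
    hG (Subgroup.commutator_mem_commutator (Subgroup.mem_top x) (Subgroup.mem_top y))
  MonoidHom.mk'
    (fun x => MonoidHom.mk' (fun y => ⟨⁅x, y⁆, mem_center x y⟩) fun y z => Subtype.ext <| by
      change ⁅x, y * z⁆ = ⁅x, y⁆ * ⁅x, z⁆
      rw [commutatorElement_mul_right_eq_mul_conj, mul_assoc _ y, mul_assoc _ _ y⁻¹,
        mem_center_iff.1 (mem_center x z), mul_inv_cancel_right])
    fun x y => MonoidHom.ext fun z => Subtype.ext <| by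
      change ⁅x * y, z⁆ = ⁅x, z⁆ * ⁅y, z⁆
      rw [commutatorElement_mul_left_eq_conj_mul, mem_center_iff.1 (mem_center y z),
        mul_inv_cancel_right, mem_center_iff.1 (mem_center y z)]

variable {hG : commutator G ≤ center G}

theorem coe_commutatorHom (x y : G) : (commutatorHom hG x y : G) = ⁅x, y⁆ := rfl

theorem commutatorHom_eq_one_iff {x y : G} : commutatorHom hG x y = 1 ↔ x * y = y * x := by
  rw [← OneMemClass.coe_eq_one, coe_commutatorHom, commutatorElement_eq_one_iff_mul_comm]

theorem commutatorHom_self (x : G) : commutatorHom hG x x = 1 := commutatorHom_eq_one_iff.2 rfl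

theorem commutatorHom_inv_swap (x y : G) : (commutatorHom hG x y)⁻¹ = commutatorHom hG y x :=
  Subtype.ext (commutatorElement_inv x y)

theorem commutatorHom_coe_right (x : G) (z : center G) : commutatorHom hG x z = 1 :=
  commutatorHom_eq_one_iff.2 (mem_center_iff.1 z.2 x)

theorem commutatorHom_coe_left (z : center G) (x : G) : commutatorHom hG z x = 1 :=
  commutatorHom_eq_one_iff.2 (mem_center_iff.1 z.2 x).symm

end ClassTwo

section HyperbolicPair

variable {G : Type u} [Group G] {hG : commutator G ≤ center G} {x x₁ x₂ : G} {c : center G}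

theorem mem_centralizer_pair_iff {g : G} : g ∈ Subgroup.centralizer {x₁, x₂} ↔
    commutatorHom hG x₁ g = 1 ∧ commutatorHom hG x₂ g = 1 := by
  simp [Subgroup.mem_centralizer_iff, commutatorHom_eq_one_iff]

theorem normal_zpowers_sup_zpowers (h : ∀ g, commutatorHom hG x g ∈ zpowers c) :
    (zpowers x ⊔ zpowers (c : G)).Normal where
  conj_mem y hy g := by
    have hle : zpowers x ⊔ zpowers (c : G) ≤ (zpowers c).comap (commutatorHom hG g) := by
      rw [sup_le_iff, Subgroup.zpowers_le, Subgroup.zpowers_le, Subgroup.mem_comap,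
        Subgroup.mem_comap, ← commutatorHom_inv_swap, commutatorHom_coe_right]
      exact ⟨inv_mem (h g), one_mem _⟩
    obtain ⟨k, hk⟩ := hle hy
    have hcomm : ⁅g, y⁆ = (c : G) ^ k := congrArg Subtype.val hk.symm
    have hconj : g * y * g⁻¹ = (c : G) ^ k * y := by
      rw [← hcomm, commutatorElement_def, inv_mul_cancel_right]
    rw [hconj]
    exact mul_mem (Subgroup.mem_sup_right ⟨k, rfl⟩) hy

theorem closure_pair_sup_centralizer_eq_top (hc : commutatorHom hG x₁ x₂ = c)
    (h₁ : ∀ g, commutatorHom hG x₁ g ∈ zpowers c) (h₂ : ∀ g, commutatorHom hG x₂ g ∈ zpowers c) :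
    closure {x₁, x₂} ⊔ Subgroup.centralizer {x₁, x₂} = ⊤ := by
  have hc' : commutatorHom hG x₂ x₁ = c⁻¹ := by rw [← hc, commutatorHom_inv_swap]
  refine eq_top_iff.2 fun g _ => ?_
  obtain ⟨n, hn⟩ := h₁ g
  obtain ⟨m, hm⟩ := h₂ g
  have ha : x₁ ^ (-m) * x₂ ^ n ∈ closure {x₁, x₂} :=
    mul_mem (zpow_mem (Subgroup.subset_closure (by simp)) _)
      (zpow_mem (Subgroup.subset_closure (by simp)) _)
  have hb : (x₁ ^ (-m) * x₂ ^ n)⁻¹ * g ∈ Subgroup.centralizer {x₁, x₂} := by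
    refine (mem_centralizer_pair_iff (hG := hG)).2 ⟨?_, ?_⟩
    · simp [hc, commutatorHom_self, ← hn]
    · simp [hc', commutatorHom_self, ← hm]
  rw [← mul_inv_cancel_left (x₁ ^ (-m) * x₂ ^ n) g]
  exact Subgroup.mul_mem_sup ha hb

theorem closure_pair_inf_centralizer_eq_zpowers {p : ℕ} (hp : p.Prime) (hexp : ∀ g : G, g ^ p = 1)
    (hc : commutatorHom hG x₁ x₂ = c) (hc1 : c ≠ 1) (h₂ : ∀ g, commutatorHom hG x₂ g ∈ zpowers c) :
    closure {x₁, x₂} ⊓ Subgroup.centralizer {x₁, x₂} = zpowers (c : G) := by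
  have hc' : commutatorHom hG x₂ x₁ = c⁻¹ := by rw [← hc, commutatorHom_inv_swap]
  have pow_eq_one {n : ℤ} (hn : c ^ n = 1) (x : G) : x ^ n = 1 := by
    have : Fact p.Prime := ⟨hp⟩
    rw [← orderOf_dvd_iff_zpow_eq_one,
      orderOf_eq_prime (Subtype.ext (hexp c)) hc1] at hn
    obtain ⟨m, rfl⟩ := hn
    rw [zpow_mul, zpow_natCast, hexp, one_zpow]
  apply le_antisymm
  · rintro a ⟨ha, hb⟩
    have hN := normal_zpowers_sup_zpowers h₂
    have hle : closure {x₁, x₂} ≤ zpowers x₁ ⊔ (zpowers x₂ ⊔ zpowers (c : G)) := by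
      rw [Subgroup.closure_le]
      rintro _ (rfl | rfl)
      · exact Subgroup.mem_sup_left (Subgroup.mem_zpowers _)
      · exact Subgroup.mem_sup_right (Subgroup.mem_sup_left (Subgroup.mem_zpowers _))
    have hcN : (zpowers (c : G)).Normal := ⟨fun z hz g => by
      rwa [mem_center_iff.1 (Subgroup.zpowers_le.2 c.2 hz) g, mul_inv_cancel_right]⟩
    obtain ⟨_, ⟨i, rfl⟩, _, hy, rfl⟩ := Subgroup.mem_sup_of_normal_right.1 (hle ha)
    obtain ⟨_, ⟨j, rfl⟩, _, ⟨k, rfl⟩, rfl⟩ := Subgroup.mem_sup_of_normal_right.1 hy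
    obtain ⟨h₁a, h₂a⟩ := (mem_centralizer_pair_iff (hG := hG)).1 hb
    simp only [map_mul, map_zpow, commutatorHom_self, commutatorHom_coe_right, hc, hc', one_zpow,
      one_mul, mul_one, inv_zpow, inv_eq_one] at h₁a h₂a
    simpa only [pow_eq_one h₂a, pow_eq_one h₁a, one_mul] using Subgroup.mem_zpowers_iff.2 ⟨k, rfl⟩
  · rw [Subgroup.zpowers_le, ← hc]
    refine ⟨?_, Subgroup.center_le_centralizer _ (commutatorHom hG x₁ x₂).2⟩
    exact Subgroup.commutator_le_self _ (Subgroup.commutator_mem_commutator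
      (Subgroup.subset_closure (by simp)) (Subgroup.subset_closure (by simp)))

theorem isNonabelianCommutatorAmalgam_of_pair {p : ℕ} (hp : p.Prime) (hexp : ∀ g : G, g ^ p = 1)
    (hc : commutatorHom hG x₁ x₂ = c) (hc1 : c ≠ 1) (h₁ : ∀ g, commutatorHom hG x₁ g ∈ zpowers c)
    (h₂ : ∀ g, commutatorHom hG x₂ g ∈ zpowers c)
    (hcB : (c : G) ∈ ⁅Subgroup.centralizer {x₁, x₂}, Subgroup.centralizer {x₁, x₂}⁆) :
    IsNonabelianCommutatorAmalgam G := by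
  refine isNonabelianCommutatorAmalgam_of_subgroups
    (Subgroup.closure_le_centralizer_centralizer {x₁, x₂})
    (closure_pair_sup_centralizer_eq_top hc h₁ h₂) (mt OneMemClass.coe_eq_one.1 hc1)
    (closure_pair_inf_centralizer_eq_zpowers hp hexp hc hc1 h₂) ?_ hcB
  rw [← hc]
  exact Subgroup.commutator_mem_commutator (Subgroup.subset_closure (by simp))
    (Subgroup.subset_closure (by simp))

end HyperbolicPair

section Abelianization

variable {G : Type u} [Group G] {p : ℕ}

theorem isCyclic_of_isCyclic_abelianization (hG : commutator G ≤ center G)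
    [IsCyclic (Abelianization G)] : IsCyclic G := by
  have hker : (Abelianization.of (G := G)).ker = commutator G := Abelianization.ker_of G
  have := Abelianization.of.isMulCommutative_of_isCyclic_of_ker_le_center (hker.trans_le hG)
  have hbot : commutator G = ⊥ := eq_bot_iff.2 (Subgroup.commutator_le.2 fun a _ b _ =>
    commutatorElement_eq_one_iff_mul_comm.2 (mul_comm' a b))
  exact isCyclic_of_injective _ ((MonoidHom.ker_eq_bot_iff _).1 (hker.trans hbot))

theorem toMul_mem_of_mem_span {A : Type*} [CommGroup A] [Module (ZMod p) (Additive A)]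
    {s : Set (Additive A)} {H : Subgroup A} (hs : ∀ a ∈ s, a.toMul ∈ H) {a : Additive A}
    (ha : a ∈ Submodule.span (ZMod p) s) : a.toMul ∈ H :=
  (Submodule.span_le.2 hs : _ ≤ AddSubgroup.toZModSubmodule p (Subgroup.toAddSubgroup H)) ha

theorem epicenter_le_commutator [Fact p.Prime] [Module (ZMod p) (Additive (Abelianization G))]
    (hG : commutator G ≤ center G) (hcyc : ¬ IsCyclic G) : epicenter G ≤ commutator G := by
  intro g hg
  by_contra hgc
  have hg0 : Additive.ofMul (Abelianization.of g) ≠ 0 := fun h =>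
    hgc ((Abelianization.ker_of G).le h)
  obtain ⟨h, hh⟩ : ∃ h : G, Additive.ofMul (Abelianization.of h) ∉
      Submodule.span (ZMod p) {Additive.ofMul (Abelianization.of g)} := by
    by_contra! hall
    have : IsCyclic (Abelianization G) := ⟨Abelianization.of g, fun x => by
      obtain ⟨x, rfl⟩ := QuotientGroup.mk_surjective x
      exact toMul_mem_of_mem_span (by rintro _ rfl; exact Subgroup.mem_zpowers _) (hall x)⟩
    exact hcyc (isCyclic_of_isCyclic_abelianization hG)
  obtain ⟨χ, hχ⟩ := exists_dual_eq_one_of_ne_zero (F := ZMod p) hg0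
  obtain ⟨ψ, hψh, hψg⟩ := exists_dual_eq_one hh
  have key := mul_comm_mul_of_mem_epicenter
    (χ.toAddMonoidHom.toMultiplicativeRight.comp Abelianization.of)
    (ψ.toAddMonoidHom.toMultiplicativeRight.comp Abelianization.of) hg h
  refine one_ne_zero (α := ZMod p) ?_
  calc (1 : ZMod p) = χ (.ofMul (.of g)) * ψ (.ofMul (.of h)) := by rw [hχ, hψh, one_mul]
    _ = χ (.ofMul (.of h)) * ψ (.ofMul (.of g)) := key
    _ = 0 := by rw [hψg _ (Submodule.mem_span_singleton_self _), mul_zero]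

end Abelianization

section Baer

variable {G : Type u} [Group G] (hG : commutator G ≤ center G)

/-- The Baer addition `x + y = x y [y, x]^h` on a group of class at most two and exponent dividing
`2 * h - 1`; commutators being central, it makes the group abelian without changing its powers. -/
@[reducible] def baerAddCommGroup (h : ℕ) (hh : ∀ g : G, g ^ (2 * h) = g) : AddCommGroup G :=
  letI : Add G := ⟨fun x y => x * y * (commutatorHom hG y x ^ h : center G)⟩
  letI : Zero G := ⟨1⟩
  letI : Neg G := ⟨fun x => x⁻¹⟩
  have add_def (x y : G) : x + y = x * y * (commutatorHom hG y x ^ h : center G) := rfl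
  have move (z : center G) (g : G) : g * z = z * g := mem_center_iff.1 z.2 g
  { nsmul := fun n x => x ^ n
    nsmul_zero := pow_zero
    nsmul_succ := fun n x => by
      change x ^ (n + 1) = x ^ n * x * (commutatorHom hG x (x ^ n) ^ h : center G)
      rw [map_pow, commutatorHom_self, one_pow, one_pow, OneMemClass.coe_one, mul_one, pow_succ]
    zsmul := zsmulRec
    add_assoc := fun x y z => by
      simp only [add_def, map_mul, MonoidHom.mul_apply, commutatorHom_coe_left,
        commutatorHom_coe_right, mul_one, mul_pow]
      rw [mul_assoc (x * y), ← move _ z, mul_assoc (x * y), mul_assoc z, ← mul_assoc x (y * z),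
        mul_assoc (x * (y * z)), ← mul_assoc x y z, mul_assoc (x * y) z]
      simp only [← Subgroup.coe_mul, mul_comm, mul_assoc]
    zero_add := fun x => by
      change 1 * x * (commutatorHom hG x 1 ^ h : center G) = x
      simp
    add_zero := fun x => by
      change x * 1 * (commutatorHom hG 1 x ^ h : center G) = x
      simp
    neg_add_cancel := fun x => by
      change x⁻¹ * x * (commutatorHom hG x x⁻¹ ^ h : center G) = 1
      simp [commutatorHom_self]
    add_comm := fun x y => by
      have hpow : commutatorHom hG x y * commutatorHom hG y x ^ h = commutatorHom hG x y ^ h := by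
        rw [← commutatorHom_inv_swap x y, inv_pow, mul_inv_eq_iff_eq_mul, ← pow_add, ← two_mul]
        exact (Subtype.ext (hh _)).symm
      have hswap : x * y = y * x * commutatorHom hG x y := by
        rw [move, coe_commutatorHom, commutatorElement_def]
        group
      rw [add_def, add_def, hswap, mul_assoc, ← Subgroup.coe_mul, hpow] }

variable {hG}

theorem exists_retraction_center {p : ℕ} [Fact p.Prime] [Module (ZMod p) (Additive (center G))]
    (hexp : ∀ g : G, g ^ p = 1) (h2 : (2 : ZMod p) ≠ 0) : ∃ q : G → Additive (center G),
      (∀ z : center G, q z = .ofMul z) ∧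
      ∀ x y, q (x * y) = q x + q y + (2⁻¹ : ZMod p) • .ofMul (commutatorHom hG x y) := by
  obtain ⟨h, hp⟩ : ∃ h, p + 1 = 2 * h := by
    rcases (Fact.out : p.Prime).eq_two_or_odd' with rfl | ⟨k, hk⟩
    · exact absurd (CharTwo.two_eq_zero (R := ZMod 2)) h2
    · exact ⟨k + 1, by omega⟩
  have hinv : (2⁻¹ : ZMod p) = h := inv_eq_of_mul_eq_one_right <| by
    simpa using (congrArg (Nat.cast (R := ZMod p)) hp).symm
  obtain ⟨_, add_def, nsmul_eq_zero⟩ : ∃ _ : AddCommGroup G,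
      (∀ x y : G, x + y = x * y * (commutatorHom hG y x ^ h : center G)) ∧ ∀ x : G, p • x = 0 :=
    ⟨baerAddCommGroup hG h fun g => by rw [← hp, pow_succ, hexp, one_mul], fun _ _ => rfl, hexp⟩
  have : Module (ZMod p) G := AddCommGroup.zmodModule nsmul_eq_zero
  have add_coe (x : G) (z : center G) : x + z = x * z := by
    rw [add_def, commutatorHom_coe_left, one_pow, OneMemClass.coe_one, mul_one]
  let incl : Additive (center G) →ₗ[ZMod p] G :=
    (AddMonoidHom.mk' (fun z => (z.toMul : G)) fun z w => (add_coe _ _).symm).toZModLinearMap p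
  obtain ⟨r, hr⟩ := incl.exists_leftInverse_of_injective
    (LinearMap.ker_eq_bot.2 fun _ _ hzw => Subtype.ext hzw)
  have hr' (z : center G) : r z = .ofMul z := LinearMap.congr_fun hr (.ofMul z)
  refine ⟨r, hr', fun x y => ?_⟩
  have hmul : x * y = x + y + (commutatorHom hG x y ^ h : center G) := by
    rw [add_coe, add_def, ← commutatorHom_inv_swap x y, inv_pow, Subgroup.coe_inv,
      inv_mul_cancel_right]
  rw [hmul, map_add, map_add, hr', hinv, Nat.cast_smul_eq_nsmul, ofMul_pow]

end Baer

section CommutatorPairing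

variable {G : Type u} [Group G] {p : ℕ} [Module (ZMod p) (Additive (Abelianization G))]
  [Module (ZMod p) (Additive (center G))] (hG : commutator G ≤ center G)

variable (p) in
/-- The commutator of a group of class at most two as a bilinear map on its abelianization, for
groups whose abelianization and center have exponent `p`. -/
def commutatorPairing : Additive (Abelianization G) →ₗ[ZMod p]
    Additive (Abelianization G) →ₗ[ZMod p] Additive (center G) :=
  let B := (Abelianization.lift (Abelianization.lift (commutatorHom hG)).flip).flip
  (AddMonoidHom.mk' (fun v => (B v.toMul).toAdditive.toZModLinearMap p) fun v w =>
    LinearMap.ext fun u => congrArg (fun f => Additive.ofMul (f u.toMul))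
      (map_mul B v.toMul w.toMul)
    ).toZModLinearMap p

variable {hG}

theorem commutatorPairing_ofMul_of (x y : G) :
    commutatorPairing p hG (.ofMul (.of x)) (.ofMul (.of y)) = .ofMul (commutatorHom hG x y) := rfl

theorem isAlt_commutatorPairing : (commutatorPairing p hG).IsAlt := fun v => by
  obtain ⟨x, rfl⟩ := QuotientGroup.mk_surjective v
  exact congrArg Additive.ofMul (commutatorHom_self (hG := hG) x)

section Epicenter

variable {c : center G}

theorem ofMul_mem_map₂_top_of_mem_commutator (hc : (c : G) ∈ commutator G) :
    Additive.ofMul c ∈ Submodule.map₂ (commutatorPairing p hG) ⊤ ⊤ := by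
  let D : Subgroup (center G) :=
    (Submodule.map₂ (commutatorPairing p hG) ⊤ ⊤).toAddSubgroup.toSubgroup'
  have hle : commutator G ≤ D.map (center G).subtype := Subgroup.commutator_le.2 fun x _ y _ =>
    ⟨commutatorHom hG x y, commutatorPairing_ofMul_of (p := p) x y ▸
      Submodule.apply_mem_map₂ (commutatorPairing p hG) trivial trivial, rfl⟩
  obtain ⟨d, hd, hdc⟩ := hle hc
  exact Subtype.ext hdc ▸ hd

theorem mem_commutator_of_ofMul_mem_map₂ {W : Submodule (ZMod p) (Additive (Abelianization G))}
    {H : Subgroup G} (hWH : ∀ x : G, Additive.ofMul (Abelianization.of x) ∈ W → x ∈ H)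
    (hc : Additive.ofMul c ∈ Submodule.map₂ (commutatorPairing p hG) W W) : (c : G) ∈ ⁅H, H⁆ := by
  rw [Submodule.map₂_eq_span_image2] at hc
  refine toMul_mem_of_mem_span (H := ⁅H, H⁆.subgroupOf (center G)) ?_ hc
  rintro _ ⟨v, hv, w, hw, rfl⟩
  obtain ⟨x, rfl⟩ := QuotientGroup.mk_surjective v
  obtain ⟨y, rfl⟩ := QuotientGroup.mk_surjective w
  exact Subgroup.commutator_mem_commutator (hWH x hv) (hWH y hw)

variable [Fact p.Prime]

theorem IsJacobi.apply_eq_zero_of_mem_epicenter (h2 : (2 : ZMod p) ≠ 0) (hexp : ∀ g : G, g ^ p = 1)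
    {T : Additive (center G) →ₗ[ZMod p] Additive (Abelianization G) →ₗ[ZMod p] ZMod p}
    (hT : IsJacobi (commutatorPairing p hG) T) (hc : (c : G) ∈ epicenter G)
    (hcG : (c : G) ∈ commutator G) : T (.ofMul c) = 0 := by
  obtain ⟨q, hqc, hq⟩ := exists_retraction_center (hG := hG) hexp h2
  obtain ⟨τ, hτ⟩ := exists_tensor_lift (S := (commutatorPairing p hG).compr₂ T)
    (fun u w => by rw [LinearMap.compr₂_apply, isAlt_commutatorPairing, map_zero,
      LinearMap.zero_apply]) hT
  let π (x : G) : Additive (Abelianization G) := .ofMul (.of x)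
  have π_mul (x y : G) : π (x * y) = π x + π y := rfl
  have π_one : π 1 = 0 := rfl
  have π_c : π c = 0 := (Abelianization.ker_of G).ge hcG
  have q_mul (x y : G) :
      q (x * y) = q x + q y + (2⁻¹ : ZMod p) • commutatorPairing p hG (π x) (π y) := by
    rw [commutatorPairing_ofMul_of, hq]
  have q_one : q 1 = 0 := hqc 1
  by_contra hTc
  obtain ⟨v, hv⟩ := DFunLike.ne_iff.1 hTc
  obtain ⟨y, rfl⟩ : ∃ y, π y = v := QuotientGroup.mk_surjective v
  -- The trilinear form `T ∘ b` is the obstruction to `T (q x) (π y)` being a cocycle; since it is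
  -- an iterated bracket of the tensor `τ`, permuted copies of `τ` cancel it.
  refine notMem_epicenter_of_cocycle (A := ZMod p) (g := c) (h := y)
    (f := fun x y => T (q x) (π y) + 2⁻¹ * (τ (π x) (π y) (π y) + τ (π x) (π y) (π x) -
      τ (π y) (π x) (π y) + τ (π y) (π y) (π x))) ?_ ?_ ?_ hc
  · intro x
    simp [π_one, q_one]
  · intro x y z
    have key := hτ (π x) (π y) (π z)
    rw [LinearMap.compr₂_apply] at key
    simp only [π_mul, q_mul, map_add, map_smul, LinearMap.add_apply, LinearMap.smul_apply,
      smul_eq_mul]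
    linear_combination (-2⁻¹ : ZMod p) * key
  · simpa [π_c, hqc] using hv

theorem isNonabelianCommutatorAmalgam_of_mem_epicenter (h2 : (2 : ZMod p) ≠ 0)
    [FiniteDimensional (ZMod p) (Additive (Abelianization G))]
    (hdim : Module.finrank (ZMod p) (Additive (Abelianization G)) ≤ 5)
    (hG : commutator G ≤ center G) (hexp : ∀ g : G, g ^ p = 1) (hc1 : c ≠ 1)
    (hc : (c : G) ∈ epicenter G) (hcG : (c : G) ∈ commutator G) :
    IsNonabelianCommutatorAmalgam G := by
  have hT T (hT : IsJacobi (commutatorPairing p hG) T) : T (.ofMul c) = 0 :=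
    hT.apply_eq_zero_of_mem_epicenter h2 hexp hc hcG
  obtain ⟨v₁, v₂, hv, h₁, h₂⟩ := exists_bracket_eq hT h2 hdim isAlt_commutatorPairing hc1
    (ofMul_mem_map₂_top_of_mem_commutator hcG)
  have hmem := mem_map₂_ker_inf_ker hT isAlt_commutatorPairing hv h₁ h₂
  obtain ⟨x₁, rfl⟩ := QuotientGroup.mk_surjective v₁
  obtain ⟨x₂, rfl⟩ := QuotientGroup.mk_surjective v₂
  have mem_zpowers {d : center G} (hd : Additive.ofMul d ∈ Submodule.span (ZMod p) {.ofMul c}) :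
      d ∈ zpowers c :=
    toMul_mem_of_mem_span (by simp) hd
  exact isNonabelianCommutatorAmalgam_of_pair (hG := hG) Fact.out hexp hv hc1
    (fun g => mem_zpowers (h₁ (.ofMul (.of g)))) (fun g => mem_zpowers (h₂ (.ofMul (.of g))))
    (mem_commutator_of_ofMul_mem_map₂ (fun x hx => (mem_centralizer_pair_iff (hG := hG)).2 hx) hmem)

end Epicenter

end CommutatorPairing

section Main

variable {G : Type u} [Group G] {p : ℕ} [Fact p.Prime]

theorem span_range_ofMul_of_eq_top [Module (ZMod p) (Additive (Abelianization G))] {ι : Type*}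
    {s : ι → G} (hs : closure (Set.range s) = ⊤) :
    Submodule.span (ZMod p) (Set.range fun i => Additive.ofMul (Abelianization.of (s i))) = ⊤ := by
  let S := Submodule.span (ZMod p) (Set.range fun i => Additive.ofMul (Abelianization.of (s i)))
  have hle : closure (Set.range s) ≤ S.toAddSubgroup.toSubgroup'.comap Abelianization.of :=
    (Subgroup.closure_le _).2 <| by
      rintro _ ⟨i, rfl⟩
      exact Submodule.subset_span ⟨i, rfl⟩
  refine eq_top_iff.2 fun v _ => ?_
  obtain ⟨x, rfl⟩ := QuotientGroup.mk_surjective v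
  exact hle (hs.ge (Subgroup.mem_top x))

theorem two_ne_zero_of_commutator_ne_bot (hexp : ∀ g : G, g ^ p = 1) (h : commutator G ≠ ⊥) :
    (2 : ZMod p) ≠ 0 := by
  contrapose! h
  have hp2 : p = 2 := (Nat.prime_dvd_prime_iff_eq Fact.out Nat.prime_two).1
    ((ZMod.natCast_eq_zero_iff 2 p).1 (by exact_mod_cast h))
  have hcomm (x y : G) : x * y = y * x :=
    Commute.of_orderOf_dvd_two (fun g => orderOf_dvd_of_pow_eq_one (hp2 ▸ hexp g)) x y
  exact eq_bot_iff.2 (Subgroup.commutator_le.2 fun x _ y _ =>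
    commutatorElement_eq_one_iff_mul_comm.2 (hcomm x y))

theorem isNonabelianCommutatorAmalgam_of_not_isCapable {ι : Type*} [Fintype ι]
    (hι : Fintype.card ι ≤ 5) {s : ι → G} (hs : closure (Set.range s) = ⊤)
    (hG : commutator G ≤ center G) (hexp : ∀ g : G, g ^ p = 1) (hcyc : ¬ IsCyclic G)
    (hcap : ¬ IsCapable G) : IsNonabelianCommutatorAmalgam G := by
  have : Module (ZMod p) (Additive (Abelianization G)) := AddCommGroup.zmodModule fun v => by
    obtain ⟨x, rfl⟩ := QuotientGroup.mk_surjective v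
    exact congrArg Abelianization.of (hexp x)
  have : Module (ZMod p) (Additive (center G)) :=
    AddCommGroup.zmodModule fun z => Subtype.ext (hexp z.toMul)
  rw [isCapable_iff_epicenter_eq_bot, Subgroup.eq_bot_iff_forall] at hcap
  push Not at hcap
  obtain ⟨g, hg, hg1⟩ := hcap
  have hgG : g ∈ commutator G := epicenter_le_commutator (p := p) hG hcyc hg
  have h2 : (2 : ZMod p) ≠ 0 := two_ne_zero_of_commutator_ne_bot hexp fun h =>
    hg1 (Subgroup.mem_bot.1 (h.le hgG))
  have hspan := span_range_ofMul_of_eq_top (p := p) hs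
  have : FiniteDimensional (ZMod p) (Additive (Abelianization G)) :=
    Module.finite_def.2 (hspan ▸ Submodule.fg_span (Set.finite_range _))
  have hdim : Module.finrank (ZMod p) (Additive (Abelianization G)) ≤ 5 := by
    rw [← finrank_top, ← hspan]
    exact (finrank_range_le_card _).trans hι
  exact isNonabelianCommutatorAmalgam_of_mem_epicenter (c := ⟨g, hG hgG⟩) h2 hdim hG hexp
    (fun h => hg1 (congrArg Subtype.val h)) hg hgG

end Main

theorem mainTheorem5 {G : Type u} [Group G] (p : ℕ) (hp : p.Prime)
    (hgen : ∃ g : Fin 5 → G, Subgroup.closure (Set.range g) = ⊤)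
    (hclass : Subgroup.lowerCentralSeries (⊤ : Subgroup G) 2 = ⊥)
    (hexp : ∀ g : G, g ^ p = 1) :
    ((IsCyclic G ∧ Nontrivial G) ∨ IsNonabelianCommutatorAmalgam G ∨ IsCapable G) ∧
    ¬ ((IsCyclic G ∧ Nontrivial G) ∧ IsNonabelianCommutatorAmalgam G) ∧
    ¬ ((IsCyclic G ∧ Nontrivial G) ∧ IsCapable G) ∧
    ¬ (IsNonabelianCommutatorAmalgam G ∧ IsCapable G) := by
  have : Fact p.Prime := ⟨hp⟩
  have hG : commutator G ≤ center G := by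
    rwa [Subgroup.lowerCentralSeries_succ, Subgroup.top_lowerCentralSeries_one,
      Subgroup.commutator_eq_bot_iff_le_centralizer, Subgroup.coe_top,
      Subgroup.centralizer_univ] at hclass
  refine ⟨?_, ?_, ?_, ?_⟩
  · obtain ⟨s, hs⟩ := hgen
    by_cases hcap : IsCapable G
    · exact .inr (.inr hcap)
    by_cases hcyc : IsCyclic G
    · exact .inl ⟨hcyc, nontrivial_of_not_isCapable hcap⟩
    · exact .inr (.inl (isNonabelianCommutatorAmalgam_of_not_isCapable (by simp) hs hG hexp hcyc
        hcap))
  · rintro ⟨⟨hcyc, -⟩, hamalgam⟩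
    exact hamalgam.not_comm IsCyclic.commGroup.mul_comm
  · rintro ⟨⟨_, _⟩, hcap⟩
    exact not_isCapable_of_isCyclic hcap
  · exact fun h => h.1.not_isCapable h.2
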